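/- Let $H$ be a complex Hilbert space and let $x \in B(H)$ with $x + x^* \ge 0$. For every integer $m \ge 1$ there is a unique $y \in B(H)$ with $y^m = x$ such that every nonzero element of the numerical range $\{\langle y h, h\rangle : h \in H,\ \|h\| = 1\}$ has argument in $(-\frac{\pi}{m}, \frac{\pi}{m})$; denote it by $x^{1/m}$. Then $x^{1/m} x \to x$ in norm as $m \to \infty$, and, if $x \neq 0$, $\|x^{1/m}\| \to 1$ as $m \to \infty$. Moreover, let $\mathrm{oa}(x)$ be the norm closed (not necessarily unital) subalgebra of $B(H)$ generated by $x$, and let $e_m = x^{1/m}/\|x^{1/m}\|$ for $m \ge 1$ (read $e_m = 0$ if $x = 0$). Then $(e_m)_{m \ge 1}$ is a contractive approximate identity for $\mathrm{oa}(x)$; that is, $e_m \in \mathrm{oa}(x)$ and $\|e_m\| \le 1$ for all $m \ge 1$, and $\|e_m a - a\| \to 0$ and $\|a e_m - a\| \to 0$ as $m \to \infty$ for every $a \in \mathrm{oa}(x)$. -/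

import Mathlib

open Filter Topology

noncomputable section

/-- The numerical range `{⟨T h, h⟩ : ‖h‖ = 1}` of a bounded operator.
(Mathlib's inner product is linear in the second variable.) -/
def numericalRange {H : Type*} [NormedAddCommGroup H] [InnerProductSpace ℂ H]
    (T : H →L[ℂ] H) : Set ℂ :=
  {z | ∃ h : H, ‖h‖ = 1 ∧ inner ℂ h (T h) = z}

/-- `y` is an `m`-th root of `x` whose numerical range has argument in `(-π/m, π/m)`
(the value `0` being allowed in the numerical range, as `Complex.arg 0 = 0`). -/
def IsSectorialRoot {H : Type*} [NormedAddCommGroup H] [InnerProductSpace ℂ H]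
    (x : H →L[ℂ] H) (m : ℕ) (y : H →L[ℂ] H) : Prop :=
  y ^ m = x ∧
    ∀ z ∈ numericalRange y, z.arg ∈ Set.Ioo (-(Real.pi / (m : ℝ))) (Real.pi / (m : ℝ))

/-- The root `x^{1/m}`: the operator singled out by `IsSectorialRoot x m`.  That there is exactly
one such operator when `x + x* ≥ 0` and `1 ≤ m` is part of the theorem. -/
def sectorialRoot {H : Type*} [NormedAddCommGroup H] [InnerProductSpace ℂ H]
    (x : H →L[ℂ] H) (m : ℕ) : H →L[ℂ] H :=
  Classical.epsilon (IsSectorialRoot x m)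

/-- `oa(x)`: the norm closed (not necessarily unital) subalgebra of `B(H)` generated by `x`. -/
def oa {H : Type*} [NormedAddCommGroup H] [InnerProductSpace ℂ H]
    (x : H →L[ℂ] H) : NonUnitalSubalgebra ℂ (H →L[ℂ] H) :=
  (NonUnitalAlgebra.adjoin ℂ {x}).topologicalClosure

/-- The sequence `e` is a (two-sided) contractive approximate identity of the algebra `A`. -/
structure IsContractiveApproxIdentity {H : Type*} [NormedAddCommGroup H] [InnerProductSpace ℂ H]
    (A : NonUnitalSubalgebra ℂ (H →L[ℂ] H)) (e : ℕ → H →L[ℂ] H) : Prop where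
  mem : ∀ n, e n ∈ A
  norm_le_one : ∀ n, ‖e n‖ ≤ 1
  tendsto_mul_left : ∀ a ∈ A, Tendsto (fun n => e n * a) atTop (𝓝 a)
  tendsto_mul_right : ∀ a ∈ A, Tendsto (fun n => a * e n) atTop (𝓝 a)

/-- The normalization `T / ‖T‖` of an operator. -/
def normalizedOp {H : Type*} [NormedAddCommGroup H] [InnerProductSpace ℂ H]
    (T : H →L[ℂ] H) : H →L[ℂ] H :=
  ((‖T‖⁻¹ : ℝ) : ℂ) • T

end

/-! For `ε > 0` the operator `X = x + ε` is strictly accretive, so `‖X - c‖ < r` for some disc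
`closedBall c r` inside the open right half plane. Von Neumann's inequality on that disc bounds
`p(X)` by the sup of `|p|`, and its companion for real parts controls the numerical range. Taking
closures gives a contractive calculus for functions holomorphic on the half plane, and `w ^ (1/m)`
yields a root of `X` with numerical range in the sector of half-angle `π/(2m)`.

Since `|(w + δ)^α - w^α| ≤ δ^α`, the roots are Cauchy as `ε → 0`; their limit is a root `z` of `x`
lying in `oa x` (`exists_root_of_accretive`). Comparing roots for different `ε` already needs
uniqueness (`eq_of_pow_eq_pow_of_isSectorial`): for commuting roots, `y^m - z^m` factors into `y -
ζz`, the sector conditions let each factor with `ζ ≠ 1` be replaced by `z`, and an accretive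
operator and its powers have the same kernel. Any competing root commutes with its power `x`, hence
with `z ∈ oa x`.

The limits come from two scalar bounds uniform on the half plane: `|w^α / (1 + δw)| ≤ δ^(-α)`
controls `‖x^{1/m}‖`, and `|(w^α - 1)w / (1 + w)^3| ≤ 3α` gives `x^{1/m} x → x`. Density and
contractivity extend the latter to all of `oa x`. -/

/-! ### Von Neumann's inequality through the operator Poisson kernel -/

section VonNeumann

open Polynomial

variable {H : Type*} [NormedAddCommGroup H] [InnerProductSpace ℂ H] [CompleteSpace H]

/-- The resolvent `(1 - e^{-iθ} T)⁻¹`. -/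
noncomputable def circleResolvent (T : H →L[ℂ] H) (θ : ℝ) : H →L[ℂ] H :=
  Ring.inverse (1 - Complex.exp (-(θ * Complex.I)) • T)

theorem norm_exp_neg_mul_I_smul (T : H →L[ℂ] H) (θ : ℝ) :
    ‖Complex.exp (-(θ * Complex.I)) • T‖ = ‖T‖ := by
  rw [norm_smul, Complex.norm_exp]; simp

theorem isUnit_one_sub_exp_smul {T : H →L[ℂ] H} (hT : ‖T‖ < 1) (θ : ℝ) :
    IsUnit (1 - Complex.exp (-(θ * Complex.I)) • T) :=
  isUnit_one_sub_of_norm_lt_one (by rwa [norm_exp_neg_mul_I_smul])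

theorem continuous_circleResolvent {T : H →L[ℂ] H} (hT : ‖T‖ < 1) :
    Continuous (circleResolvent T) := by
  rw [continuous_iff_continuousAt]
  intro θ
  obtain ⟨u, hu⟩ := isUnit_one_sub_exp_smul hT θ
  have h1 : ContinuousAt Ring.inverse (1 - Complex.exp (-(θ * Complex.I)) • T) := by
    rw [← hu]; exact NormedRing.inverse_continuousAt u
  have h2 : ContinuousAt (fun θ : ℝ => 1 - Complex.exp (-(θ * Complex.I)) • T) θ := by
    fun_prop
  exact ContinuousAt.comp (f := fun θ : ℝ => 1 - Complex.exp (-(θ * Complex.I)) • T) h1 h2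

theorem circleResolvent_eq {T : H →L[ℂ] H} (hT : ‖T‖ < 1) (θ : ℝ) :
    circleResolvent T θ = 1 + Complex.exp (-(θ * Complex.I)) • (T * circleResolvent T θ) := by
  have h := Ring.mul_inverse_cancel _ (isUnit_one_sub_exp_smul hT θ)
  rw [sub_mul, one_mul, smul_mul_assoc, sub_eq_iff_eq_add] at h
  exact h

/-- The Fourier coefficients of the resolvent on the circle. -/
noncomputable def resolventCoeff (T : H →L[ℂ] H) (l : ℤ) : H →L[ℂ] H :=
  ∫ θ in (0 : ℝ)..(2 * Real.pi), Complex.exp (l * θ * Complex.I) • circleResolvent T θ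

theorem integral_exp_int_mul (l : ℤ) :
    ∫ θ in (0 : ℝ)..(2 * Real.pi), Complex.exp (l * θ * Complex.I) =
      if l = 0 then 2 * (Real.pi : ℂ) else 0 := by
  split_ifs with h
  · simp [h]
  · have h' : (l : ℂ) * Complex.I ≠ 0 := by
      simp [h]
    have := integral_exp_mul_complex (a := 0) (b := 2 * Real.pi) h'
    calc _ = ∫ θ in (0 : ℝ)..(2 * Real.pi), Complex.exp (l * Complex.I * θ) := by
          congr 1; ext θ; congr 1; ring
      _ = 0 := by
          rw [this]
          have : (l : ℂ) * Complex.I * ((2 * Real.pi : ℝ) : ℂ) = l * (2 * Real.pi * Complex.I) := by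
            push_cast; ring
          rw [this, Complex.exp_int_mul_two_pi_mul_I]
          simp

theorem resolventCoeff_eq {T : H →L[ℂ] H} (hT : ‖T‖ < 1) (l : ℤ) :
    resolventCoeff T l =
      (if l = 0 then 2 * (Real.pi : ℂ) else 0) • 1 + T * resolventCoeff T (l - 1) := by
  have hc := continuous_circleResolvent hT
  unfold resolventCoeff
  rw [← integral_exp_int_mul l, ← intervalIntegral.integral_smul_const]
  have h1 : T * ∫ θ in (0 : ℝ)..(2 * Real.pi),
      Complex.exp ((l - 1 : ℤ) * θ * Complex.I) • circleResolvent T θ =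
      ∫ θ in (0 : ℝ)..(2 * Real.pi),
        T * (Complex.exp ((l - 1 : ℤ) * θ * Complex.I) • circleResolvent T θ) := by
    refine ((ContinuousLinearMap.mul ℂ (H →L[ℂ] H) T).intervalIntegral_comp_comm ?_).symm
    exact Continuous.intervalIntegrable (by fun_prop) _ _
  rw [h1, ← intervalIntegral.integral_add]
  · congr 1
    ext1 θ
    nth_rewrite 1 [circleResolvent_eq hT θ]
    rw [smul_add, smul_smul, ← Complex.exp_add, mul_smul_comm]
    congr 3
    push_cast; ring_nf
  · exact Continuous.intervalIntegrable (by fun_prop) _ _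
  · exact Continuous.intervalIntegrable (by fun_prop) _ _

theorem exists_norm_resolventCoeff_le (T : H →L[ℂ] H) :
    ∃ C, ∀ l, ‖resolventCoeff T l‖ ≤ C := by
  refine ⟨∫ θ in (0 : ℝ)..(2 * Real.pi), ‖circleResolvent T θ‖, fun l => ?_⟩
  refine (intervalIntegral.norm_integral_le_integral_norm (by positivity)).trans_eq ?_
  congr 1; ext θ
  rw [norm_smul, Complex.norm_exp]; simp

/-- Below index zero the recursion has no constant term, so the coefficient is `T ^ n` times a
coefficient further left. The coefficients are uniformly bounded and `‖T‖ ^ n → 0`. -/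
theorem resolventCoeff_of_neg {T : H →L[ℂ] H} (hT : ‖T‖ < 1) {l : ℤ} (hl : l < 0) :
    resolventCoeff T l = 0 := by
  obtain ⟨C, hC⟩ := exists_norm_resolventCoeff_le T
  have key : ∀ n : ℕ, resolventCoeff T l = T ^ n * resolventCoeff T (l - n) := by
    intro n
    induction n with
    | zero => simp
    | succ n ih =>
      rw [ih, resolventCoeff_eq hT (l - n), if_neg (by lia), zero_smul, zero_add, pow_succ, mul_assoc]
      congr 3; push_cast; ring
  have hle : ∀ n : ℕ, ‖resolventCoeff T l‖ ≤ ‖T‖ ^ n * C := fun n => by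
    cases n with
    | zero => simpa using hC l
    | succ n =>
      rw [key (n + 1)]
      exact (norm_mul_le _ _).trans (mul_le_mul (norm_pow_le' _ n.succ_pos) (hC _)
        (norm_nonneg _) (by positivity))
  have ht : Tendsto (fun n : ℕ => ‖T‖ ^ n * C) atTop (𝓝 (0 * C)) :=
    (tendsto_pow_atTop_nhds_zero_of_lt_one (norm_nonneg _) hT).mul_const C
  rw [zero_mul] at ht
  exact norm_le_zero_iff.1 (ge_of_tendsto' ht hle)

theorem resolventCoeff_natCast {T : H →L[ℂ] H} (hT : ‖T‖ < 1) (n : ℕ) :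
    resolventCoeff T n = (2 * (Real.pi : ℂ)) • T ^ n := by
  induction n with
  | zero => rw [resolventCoeff_eq hT, resolventCoeff_of_neg hT (by simp)]; simp
  | succ n ih =>
    rw [resolventCoeff_eq hT, if_neg (by lia)]
    push_cast
    rw [add_sub_cancel_right, ih, zero_smul, zero_add, mul_smul_comm, pow_succ']

theorem integral_exp_smul_star_circleResolvent {T : H →L[ℂ] H} (hT : ‖T‖ < 1) (l : ℤ) :
    ∫ θ in (0 : ℝ)..(2 * Real.pi), Complex.exp (l * θ * Complex.I) • star (circleResolvent T θ) =
      star (resolventCoeff T (-l)) := by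
  have hc := continuous_circleResolvent hT
  unfold resolventCoeff
  -- The adjoint is only conjugate-linear over `ℂ`, so it is moved through the integral as a
  -- real-linear map.
  rw [← starL'_apply (R := ℝ)]
  erw [← ContinuousLinearMap.intervalIntegral_comp_comm
    ((starL' ℝ : (H →L[ℂ] H) ≃L[ℝ] (H →L[ℂ] H)) : (H →L[ℂ] H) →L[ℝ] (H →L[ℂ] H))
    (Continuous.intervalIntegrable (by fun_prop) _ _)]
  congr 1
  ext1 θ
  simp only [ContinuousLinearEquiv.coe_coe, starL'_apply, star_smul]
  congr 1
  rw [Complex.star_def, ← Complex.exp_conj]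
  simp

/-- The operator Poisson kernel. -/
noncomputable def poissonOp (T : H →L[ℂ] H) (θ : ℝ) : H →L[ℂ] H :=
  circleResolvent T θ + star (circleResolvent T θ) - 1

theorem continuous_poissonOp {T : H →L[ℂ] H} (hT : ‖T‖ < 1) : Continuous (poissonOp T) := by
  have hc := continuous_circleResolvent hT
  unfold poissonOp
  fun_prop

/-- This form makes positivity visible. With `S = e^{-iθ} T`, it is `1 - S*S = (1 - S) + (1 - S*) -
(1 - S*)(1 - S)` conjugated by the resolvent. -/
theorem poissonOp_eq {T : H →L[ℂ] H} (hT : ‖T‖ < 1) (θ : ℝ) :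
    poissonOp T θ = star (circleResolvent T θ) * (1 - star T * T) * circleResolvent T θ := by
  have h := Ring.mul_inverse_cancel _ (isUnit_one_sub_exp_smul hT θ)
  change (1 - Complex.exp (-(θ * Complex.I)) • T) * circleResolvent T θ = 1 at h
  set S := Complex.exp (-(θ * Complex.I)) • T with hS
  have hST : star S * S = star T * T := by
    rw [hS, star_smul, smul_mul_smul_comm, Complex.star_def, Complex.conj_mul', Complex.norm_exp]
    simp
  set R := circleResolvent T θ
  have h' : star R * (1 - star S) = 1 := by
    have := congrArg star h
    simpa using this
  have e : 1 - star T * T = (1 - S) + (1 - star S) - (1 - star S) * (1 - S) := by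
    rw [← hST]; noncomm_ring
  unfold poissonOp
  rw [e]
  calc R + star R - 1 = (star R * (1 - star S)) * R + star R * ((1 - S) * R)
          - (star R * (1 - star S)) * ((1 - S) * R) := by rw [h, h']; simp
    _ = _ := by noncomm_ring

theorem poissonOp_nonneg {T : H →L[ℂ] H} (hT : ‖T‖ < 1) (θ : ℝ) : 0 ≤ poissonOp T θ := by
  rw [poissonOp_eq hT]
  refine star_left_conjugate_nonneg ?_ _
  rw [sub_nonneg]
  refine CStarAlgebra.star_mul_le_algebraMap_norm_sq.trans ?_
  rw [← map_one (algebraMap ℝ (H →L[ℂ] H))]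
  exact algebraMap_mono _ (by nlinarith [norm_nonneg T])

/-- On `w ^ n` the resolvent contributes `2π T ^ n`; its adjoint contributes only for `n = 0`, where
the term `-1` cancels it. -/
theorem integral_eval_smul_poissonOp {T : H →L[ℂ] H} (hT : ‖T‖ < 1) (p : ℂ[X]) :
    ∫ θ in (0 : ℝ)..(2 * Real.pi), p.eval (Complex.exp (θ * Complex.I)) • poissonOp T θ =
      (2 * (Real.pi : ℂ)) • aeval T p := by
  have hP := continuous_poissonOp hT
  have hc := continuous_circleResolvent hT
  induction p using Polynomial.induction_on' with
  | add p q hp hq =>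
    simp only [eval_add, add_smul, map_add, smul_add]
    rw [intervalIntegral.integral_add, hp, hq]
    all_goals exact Continuous.intervalIntegrable (by fun_prop) _ _
  | monomial n a =>
    have e : ∀ θ : ℝ, (monomial n a).eval (Complex.exp (θ * Complex.I)) • poissonOp T θ =
        a • ((Complex.exp ((n : ℤ) * θ * Complex.I) • circleResolvent T θ +
          Complex.exp ((n : ℤ) * θ * Complex.I) • star (circleResolvent T θ)) -
          Complex.exp ((n : ℤ) * θ * Complex.I) • (1 : H →L[ℂ] H)) := by
      intro θ
      rw [eval_monomial, ← Complex.exp_nat_mul, ← smul_add, ← smul_sub, smul_smul]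
      simp only [poissonOp, Int.cast_natCast, mul_assoc]
    simp only [e]
    rw [intervalIntegral.integral_smul, intervalIntegral.integral_sub,
      intervalIntegral.integral_add, intervalIntegral.integral_smul_const, integral_exp_int_mul,
      integral_exp_smul_star_circleResolvent hT]
    · change a • (resolventCoeff T n + _ - _) = _
      rw [resolventCoeff_natCast hT, aeval_monomial, Algebra.algebraMap_eq_smul_one, smul_mul_assoc,
        one_mul]
      rcases Nat.eq_zero_or_pos n with rfl | hn
      · have : resolventCoeff T (-((0 : ℕ) : ℤ)) = (2 * (Real.pi : ℂ)) • 1 := by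
          simpa using resolventCoeff_natCast hT 0
        rw [this]
        simp [star_smul]
        module
      · rw [resolventCoeff_of_neg hT (by lia), if_neg (by lia)]
        simp
        module
    all_goals exact Continuous.intervalIntegrable (by fun_prop) _ _

theorem integral_eval_mul_inner_poissonOp {T : H →L[ℂ] H} (hT : ‖T‖ < 1) (p : ℂ[X]) (h k : H) :
    ∫ θ in (0 : ℝ)..(2 * Real.pi),
      p.eval (Complex.exp (θ * Complex.I)) * inner ℂ k (poissonOp T θ h) =
      2 * (Real.pi : ℂ) * inner ℂ k (aeval T p h) := by
  have hP := continuous_poissonOp hT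
  have := ContinuousLinearMap.intervalIntegral_comp_comm (𝕜 := ℂ) (μ := MeasureTheory.volume)
    (a := 0) (b := 2 * Real.pi)
    (f := fun θ : ℝ => p.eval (Complex.exp (θ * Complex.I)) • poissonOp T θ)
    ((innerSL ℂ k).comp (ContinuousLinearMap.apply ℂ H h))
    (Continuous.intervalIntegrable (by fun_prop) _ _)
  rw [integral_eval_smul_poissonOp hT] at this
  simpa [inner_smul_right] using this

theorem integral_re_inner_poissonOp {T : H →L[ℂ] H} (hT : ‖T‖ < 1) (h : H) :
    ∫ θ in (0 : ℝ)..(2 * Real.pi), (inner ℂ h (poissonOp T θ h)).re = 2 * Real.pi * ‖h‖ ^ 2 := by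
  have hP := continuous_poissonOp hT
  have h1 := integral_eval_mul_inner_poissonOp hT 1 h h
  simp only [eval_one, one_mul, map_one, one_apply_eq_self,
    inner_self_eq_norm_sq_to_K] at h1
  have h2 := ContinuousLinearMap.intervalIntegral_comp_comm (𝕜 := ℝ) (μ := MeasureTheory.volume)
    (a := 0) (b := 2 * Real.pi) (f := fun θ : ℝ => inner ℂ h (poissonOp T θ h))
    Complex.reCLM (Continuous.intervalIntegrable (by fun_prop) _ _)
  rw [h1] at h2
  simp only [Complex.reCLM_apply] at h2
  rw [h2]
  have e : (2 * (Real.pi : ℂ) * (‖h‖ : ℂ) ^ 2) = ((2 * Real.pi * ‖h‖ ^ 2 : ℝ) : ℂ) := by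
    push_cast; ring
  exact (congrArg Complex.re e).trans (Complex.ofReal_re _)

/-- Cauchy–Schwarz for the form of `P`, weakened by AM–GM: the sum, unlike the geometric mean,
integrates exactly over the circle. -/
theorem norm_inner_le_of_nonneg {P : H →L[ℂ] H} (hP : 0 ≤ P) (h k : H) :
    ‖(inner ℂ k (P h) : ℂ)‖ ≤ ((inner ℂ h (P h)).re + (inner ℂ k (P k)).re) / 2 := by
  obtain ⟨S, rfl⟩ := CStarAlgebra.nonneg_iff_eq_star_mul_self.1 hP
  have e : ∀ u v : H, inner ℂ u ((star S * S) v) = inner ℂ (S u) (S v) := fun u v => by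
    rw [mul_apply_eq_comp, ContinuousLinearMap.star_eq_adjoint,
      ContinuousLinearMap.adjoint_inner_right]
  have e' : ∀ u : H, (inner ℂ (S u) (S u)).re = ‖S u‖ ^ 2 := fun u =>
    (norm_sq_eq_re_inner (𝕜 := ℂ) (S u)).symm
  rw [e, e, e, e', e']
  nlinarith [norm_inner_le_norm (𝕜 := ℂ) (S k) (S h), sq_nonneg (‖S k‖ - ‖S h‖)]

/-- **von Neumann's inequality** for a strict contraction. -/
theorem norm_aeval_le_of_norm_lt_one {T : H →L[ℂ] H} (hT : ‖T‖ < 1) (p : ℂ[X]) {M : ℝ}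
    (hM : ∀ w : ℂ, ‖w‖ ≤ 1 → ‖p.eval w‖ ≤ M) : ‖aeval T p‖ ≤ M := by
  have hP := continuous_poissonOp hT
  have hM0 : 0 ≤ M := (norm_nonneg _).trans (hM 0 (by simp))
  have key : ∀ h k : H, ‖(inner ℂ k (aeval T p h) : ℂ)‖ ≤ M * ((‖h‖ ^ 2 + ‖k‖ ^ 2) / 2) := by
    intro h k
    have h1 : ‖∫ θ in (0 : ℝ)..(2 * Real.pi),
        p.eval (Complex.exp (θ * Complex.I)) * inner ℂ k (poissonOp T θ h)‖ ≤
        ∫ θ in (0 : ℝ)..(2 * Real.pi),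
          (M / 2 * (inner ℂ h (poissonOp T θ h)).re + M / 2 * (inner ℂ k (poissonOp T θ k)).re) := by
      refine intervalIntegral.norm_integral_le_of_norm_le (by positivity) (.of_forall ?_)
        (Continuous.intervalIntegrable (by fun_prop) _ _)
      intro θ _
      rw [norm_mul]
      have h2 := norm_inner_le_of_nonneg (poissonOp_nonneg hT θ) h k
      have h3 := hM (Complex.exp (θ * Complex.I)) (by rw [Complex.norm_exp]; simp)
      nlinarith [mul_le_mul h3 h2 (norm_nonneg _) hM0]
    rw [integral_eval_mul_inner_poissonOp hT, intervalIntegral.integral_add,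
      intervalIntegral.integral_const_mul, intervalIntegral.integral_const_mul,
      integral_re_inner_poissonOp hT, integral_re_inner_poissonOp hT, norm_mul] at h1
    · have h4 : ‖2 * (Real.pi : ℂ)‖ = 2 * Real.pi := by
        rw [norm_mul, Complex.norm_real, Real.norm_of_nonneg Real.pi_pos.le]; simp
      rw [h4] at h1
      have := Real.pi_pos
      refine le_of_mul_le_mul_left (h1.trans_eq ?_) (by positivity : 0 < 2 * Real.pi)
      ring
    all_goals exact Continuous.intervalIntegrable (by fun_prop) _ _
  refine ContinuousLinearMap.opNorm_le_of_unit_norm (𝕜 := ℂ) hM0 fun h hh => ?_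
  by_cases h0 : aeval T p h = 0
  · simpa [h0] using hM0
  -- Testing against the unit vector along `p(T) h` turns the bound on the form into a bound on the
  -- norm.
  have h1 := key h ((‖aeval T p h‖⁻¹ : ℂ) • aeval T p h)
  have hn : ‖aeval T p h‖ ≠ 0 := norm_ne_zero_iff.2 h0
  rw [inner_smul_left, inner_self_eq_norm_sq_to_K, norm_smul, hh, norm_mul] at h1
  simp only [map_inv₀, Complex.conj_ofReal, norm_inv, Complex.norm_real, norm_norm,
    Complex.coe_algebraMap, norm_pow, inv_mul_cancel₀ hn] at h1
  calc ‖aeval T p h‖ = ‖aeval T p h‖⁻¹ * ‖aeval T p h‖ ^ 2 := by field_simp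
    _ ≤ _ := h1
    _ = M := by ring

/-- The form of the Poisson kernel at `h` is a positive density of total mass `2π‖h‖²`, so the form
of `p(T)` at `h` is an average of the values of `p` on the circle, times `‖h‖²`. -/
theorem le_re_inner_aeval_of_norm_lt_one {T : H →L[ℂ] H} (hT : ‖T‖ < 1) (p : ℂ[X]) {a : ℝ}
    (ha : ∀ w : ℂ, ‖w‖ ≤ 1 → a ≤ (p.eval w).re) (h : H) :
    a * ‖h‖ ^ 2 ≤ (inner ℂ h (aeval T p h)).re := by
  have hP := continuous_poissonOp hT
  have h2 := ContinuousLinearMap.intervalIntegral_comp_comm (𝕜 := ℝ) (μ := MeasureTheory.volume)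
    (a := 0) (b := 2 * Real.pi)
    (f := fun θ : ℝ => p.eval (Complex.exp (θ * Complex.I)) * inner ℂ h (poissonOp T θ h))
    Complex.reCLM (Continuous.intervalIntegrable (by fun_prop) _ _)
  rw [integral_eval_mul_inner_poissonOp hT] at h2
  simp only [Complex.reCLM_apply] at h2
  have h3 : (2 * (Real.pi : ℂ) * inner ℂ h (aeval T p h)).re =
      2 * Real.pi * (inner ℂ h (aeval T p h)).re := by
    rw [show (2 * (Real.pi : ℂ)) = ((2 * Real.pi : ℝ) : ℂ) by push_cast; ring, Complex.re_ofReal_mul]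
  have h1 : ∫ θ in (0 : ℝ)..(2 * Real.pi), a * (inner ℂ h (poissonOp T θ h)).re ≤
      ∫ θ in (0 : ℝ)..(2 * Real.pi),
        (p.eval (Complex.exp (θ * Complex.I)) * inner ℂ h (poissonOp T θ h)).re := by
    refine intervalIntegral.integral_mono_on (by positivity)
      (Continuous.intervalIntegrable (by fun_prop) _ _)
      (Continuous.intervalIntegrable (by fun_prop) _ _) fun θ _ => ?_
    have hpos := ((ContinuousLinearMap.nonneg_iff_isPositive _).1
      (poissonOp_nonneg hT θ)).inner_nonneg_right h
    rw [Complex.le_def] at hpos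
    rw [Complex.mul_re, ← hpos.2]
    simp only [Complex.zero_im, mul_zero, sub_zero]
    exact mul_le_mul_of_nonneg_right (ha _ (by rw [Complex.norm_exp]; simp)) hpos.1
  rw [h2, h3, intervalIntegral.integral_const_mul, integral_re_inner_poissonOp hT] at h1
  have := Real.pi_pos
  refine le_of_mul_le_mul_left (le_trans (le_of_eq ?_) h1) (by positivity : 0 < 2 * Real.pi)
  ring

theorem exists_strict_contraction_aeval {X : H →L[ℂ] H} {c : ℂ} {r : ℝ} (hr : ‖X - c • 1‖ < r)
    (p : ℂ[X]) : ∃ (T : H →L[ℂ] H) (q : ℂ[X]), ‖T‖ < 1 ∧ aeval T q = aeval X p ∧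
      ∀ w : ℂ, ‖w‖ ≤ 1 → ∃ v ∈ Metric.closedBall c r, q.eval w = p.eval v := by
  have hr0 : 0 < r := (norm_nonneg _).trans_lt hr
  have hrc : (r : ℂ) ≠ 0 := by exact_mod_cast hr0.ne'
  refine ⟨(r : ℂ)⁻¹ • (X - c • 1), p.comp (C c + C (r : ℂ) * Polynomial.X), ?_, ?_, ?_⟩
  · rw [norm_smul, norm_inv, Complex.norm_real, Real.norm_of_nonneg hr0.le, inv_mul_lt_iff₀ hr0]
    simpa using hr
  · rw [aeval_comp]
    congr 1
    simp only [map_add, map_mul, aeval_C, aeval_X, Algebra.algebraMap_eq_smul_one, smul_mul_assoc,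
      one_mul, smul_smul, mul_inv_cancel₀ hrc, one_smul]
    rw [add_sub_cancel]
  · intro w hw
    refine ⟨c + r * w, ?_, by simp⟩
    rw [mem_closedBall_iff_norm, add_sub_cancel_left, norm_mul, Complex.norm_real,
      Real.norm_of_nonneg hr0.le]
    nlinarith

theorem norm_aeval_le_of_norm_sub_lt {X : H →L[ℂ] H} {c : ℂ} {r : ℝ} (hr : ‖X - c • 1‖ < r)
    (p : ℂ[X]) {M : ℝ} (hM : ∀ w ∈ Metric.closedBall c r, ‖p.eval w‖ ≤ M) : ‖aeval X p‖ ≤ M := by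
  obtain ⟨T, q, hT, hq, hv⟩ := exists_strict_contraction_aeval hr p
  rw [← hq]
  refine norm_aeval_le_of_norm_lt_one hT q fun w hw => ?_
  obtain ⟨v, hv, e⟩ := hv w hw
  exact e ▸ hM v hv

theorem le_re_inner_aeval_of_norm_sub_lt {X : H →L[ℂ] H} {c : ℂ} {r : ℝ} (hr : ‖X - c • 1‖ < r)
    (p : ℂ[X]) {a : ℝ} (ha : ∀ w ∈ Metric.closedBall c r, a ≤ (p.eval w).re) (h : H) :
    a * ‖h‖ ^ 2 ≤ (inner ℂ h (aeval X p h)).re := by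
  obtain ⟨T, q, hT, hq, hv⟩ := exists_strict_contraction_aeval hr p
  rw [← hq]
  refine le_re_inner_aeval_of_norm_lt_one hT q (fun w hw => ?_) h
  obtain ⟨v, hv, e⟩ := hv w hw
  exact e ▸ ha v hv

end VonNeumann

/-! ### The closed polynomial calculus on a disc -/

section DiscCalculus

open Polynomial

variable {H : Type*} [NormedAddCommGroup H] [InnerProductSpace ℂ H] [CompleteSpace H]

/-- The closed graph of the polynomial functional calculus of `X` over the disc
`closedBall c r`: the closure of the set of all pairs `(p, p(X))`. -/
noncomputable def discGraph (X : H →L[ℂ] H) (c : ℂ) (r : ℝ) :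
    Subalgebra ℂ (C(Metric.closedBall c r, ℂ) × (H →L[ℂ] H)) :=
  ((toContinuousMapOnAlgHom (Metric.closedBall c r)).prod (aeval X)).range.topologicalClosure

theorem mem_discGraph_iff {X : H →L[ℂ] H} {c : ℂ} {r : ℝ}
    {f : C(Metric.closedBall c r, ℂ)} {A : H →L[ℂ] H} :
    (f, A) ∈ discGraph X c r ↔ ∃ p : ℕ → ℂ[X],
      Tendsto (fun n => toContinuousMapOnAlgHom (Metric.closedBall c r) (p n)) atTop (𝓝 f) ∧
      Tendsto (fun n => aeval X (p n)) atTop (𝓝 A) := by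
  rw [discGraph, ← SetLike.mem_coe, Subalgebra.topologicalClosure_coe, mem_closure_iff_seq_limit]
  constructor
  · rintro ⟨u, hu, ht⟩
    choose p hp using hu
    obtain rfl : u = fun n => (toContinuousMapOnAlgHom (Metric.closedBall c r) (p n),
      aeval X (p n)) := funext fun n => (hp n).symm
    rw [nhds_prod_eq, tendsto_prod_iff'] at ht
    exact ⟨p, ht⟩
  · rintro ⟨p, h1, h2⟩
    exact ⟨_, fun n => ⟨p n, rfl⟩, h1.prodMk_nhds h2⟩

theorem polynomial_mem_discGraph (X : H →L[ℂ] H) (c : ℂ) (r : ℝ) (p : ℂ[X]) :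
    (toContinuousMapOnAlgHom (Metric.closedBall c r) p, aeval X p) ∈ discGraph X c r :=
  mem_discGraph_iff.2 ⟨fun _ => p, tendsto_const_nhds, tendsto_const_nhds⟩

theorem norm_aeval_le_norm_toContinuousMapOn {X : H →L[ℂ] H} {c : ℂ} {r : ℝ}
    (hr : ‖X - c • 1‖ < r) (p : ℂ[X]) :
    ‖aeval X p‖ ≤ ‖toContinuousMapOnAlgHom (Metric.closedBall c r) p‖ :=
  norm_aeval_le_of_norm_sub_lt hr p fun w hw =>
    ContinuousMap.norm_coe_le_norm (toContinuousMapOnAlgHom (Metric.closedBall c r) p) ⟨w, hw⟩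

theorem norm_le_of_mem_discGraph {X : H →L[ℂ] H} {c : ℂ} {r : ℝ} (hr : ‖X - c • 1‖ < r)
    {f : C(Metric.closedBall c r, ℂ)} {A : H →L[ℂ] H} (h : (f, A) ∈ discGraph X c r) :
    ‖A‖ ≤ ‖f‖ := by
  obtain ⟨p, h1, h2⟩ := mem_discGraph_iff.1 h
  exact le_of_tendsto_of_tendsto' h2.norm h1.norm
    fun n => norm_aeval_le_norm_toContinuousMapOn hr (p n)

/-- The closed graph is the graph of a function, and since it is a subalgebra, multiplicativity of
the calculus is automatic. -/
theorem eq_of_mem_discGraph {X : H →L[ℂ] H} {c : ℂ} {r : ℝ} (hr : ‖X - c • 1‖ < r)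
    {f : C(Metric.closedBall c r, ℂ)} {A B : H →L[ℂ] H} (hA : (f, A) ∈ discGraph X c r)
    (hB : (f, B) ∈ discGraph X c r) : A = B := by
  have h : (f - f, A - B) ∈ discGraph X c r := (discGraph X c r).sub_mem hA hB
  have := norm_le_of_mem_discGraph hr h
  rw [sub_self, norm_zero, norm_le_zero_iff, sub_eq_zero] at this
  exact this

theorem re_inner_nonneg_of_mem_discGraph {X : H →L[ℂ] H} {c : ℂ} {r : ℝ} (hr : ‖X - c • 1‖ < r)
    {f : C(Metric.closedBall c r, ℂ)} {A : H →L[ℂ] H} (hA : (f, A) ∈ discGraph X c r)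
    (hf : ∀ w, 0 ≤ (f w).re) (h : H) : 0 ≤ (inner ℂ h (A h)).re := by
  obtain ⟨p, h1, h2⟩ := mem_discGraph_iff.1 hA
  have h3 : ∀ n, -‖toContinuousMapOnAlgHom (Metric.closedBall c r) (p n) - f‖ * ‖h‖ ^ 2 ≤
      (inner ℂ h (aeval X (p n) h)).re := fun n => by
    refine le_re_inner_aeval_of_norm_sub_lt hr (p n) (fun w hw => ?_) h
    have h4 := ContinuousMap.norm_coe_le_norm
      (toContinuousMapOnAlgHom (Metric.closedBall c r) (p n) - f) ⟨w, hw⟩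
    have h5 := (Complex.abs_re_le_norm _).trans h4
    have h6 : ((toContinuousMapOnAlgHom (Metric.closedBall c r) (p n) - f) ⟨w, hw⟩).re =
      ((p n).eval w).re - (f ⟨w, hw⟩).re := rfl
    rw [h6] at h5
    have := hf ⟨w, hw⟩
    have := (abs_le.1 h5).1
    linarith
  have h4 : Tendsto (fun n => -‖toContinuousMapOnAlgHom (Metric.closedBall c r) (p n) - f‖ *
      ‖h‖ ^ 2) atTop (𝓝 (-‖f - f‖ * ‖h‖ ^ 2)) :=
    ((h1.sub_const f).norm.neg).mul_const _
  have h5 : Tendsto (fun n => (inner ℂ h (aeval X (p n) h)).re) atTop (𝓝 (inner ℂ h (A h)).re) := by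
    have hc : Continuous fun B : H →L[ℂ] H => (inner ℂ h (B h)).re := by fun_prop
    exact (hc.tendsto A).comp h2
  rw [sub_self, norm_zero, neg_zero, zero_mul] at h4
  exact le_of_tendsto_of_tendsto' h4 h5 h3

theorem exists_polynomial_tendsto {c : ℂ} {r R : ℝ} (hr : 0 < r) (hR : r < R) {f : ℂ → ℂ}
    (hf : DifferentiableOn ℂ f (Metric.ball c R)) (g : C(Metric.closedBall c r, ℂ))
    (hg : ∀ w, g w = f w) : ∃ p : ℕ → ℂ[X],
      Tendsto (fun n => toContinuousMapOnAlgHom (Metric.closedBall c r) (p n)) atTop (𝓝 g) := by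
  -- `R₂` keeps the Cauchy circle inside the domain; `R₁` leaves room for uniform convergence of the
  -- Taylor series on the closed disc of radius `r`.
  obtain ⟨R₂, h2, h2'⟩ := exists_between hR
  obtain ⟨R₁, h1, h1'⟩ := exists_between h2
  have hR₁ : 0 < R₁ := hr.trans h1
  have hR₂ : 0 < R₂ := hR₁.trans h1'
  lift R₁ to NNReal using hR₁.le
  lift R₂ to NNReal using hR₂.le
  have hps := (hf.mono (Metric.closedBall_subset_ball h2')).hasFPowerSeriesOnBall
    (by exact_mod_cast hR₂)
  have hu := hps.tendstoUniformlyOn (r' := R₁) (by exact_mod_cast h1')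
  refine ⟨fun n => ∑ k ∈ Finset.range n,
    C ((cauchyPowerSeries f c R₂).coeff k) * (Polynomial.X - C c) ^ k, ?_⟩
  rw [ContinuousMap.tendsto_iff_tendstoUniformly, Metric.tendstoUniformly_iff]
  rw [Metric.tendstoUniformlyOn_iff] at hu
  intro ε hε
  filter_upwards [hu ε hε] with n hn w
  have hw : (w : ℂ) - c ∈ Metric.ball (0 : ℂ) R₁ := by
    rw [mem_ball_zero_iff]
    exact (mem_closedBall_iff_norm.1 w.2).trans_lt h1
  have h3 := hn _ hw
  rw [add_sub_cancel, ← hg] at h3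
  convert h3 using 2
  simp [FormalMultilinearSeries.partialSum, mul_comm]

theorem exists_mem_discGraph {X : H →L[ℂ] H} {c : ℂ} {r R : ℝ} (hr : ‖X - c • 1‖ < r)
    (hR : r < R) {f : ℂ → ℂ} (hf : DifferentiableOn ℂ f (Metric.ball c R))
    (g : C(Metric.closedBall c r, ℂ)) (hg : ∀ w, g w = f w) :
    ∃ A, (g, A) ∈ discGraph X c r := by
  obtain ⟨p, hp⟩ := exists_polynomial_tendsto ((norm_nonneg _).trans_lt hr) hR hf g hg
  have hc : CauchySeq fun n => aeval X (p n) := by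
    rw [Metric.cauchySeq_iff]
    intro ε hε
    obtain ⟨N, hN⟩ := Metric.cauchySeq_iff.1 hp.cauchySeq ε hε
    refine ⟨N, fun m hm n hn => ?_⟩
    have := hN m hm n hn
    rw [dist_eq_norm, ← map_sub] at this ⊢
    exact (norm_aeval_le_norm_toContinuousMapOn hr _).trans_lt this
  obtain ⟨A, hA⟩ := cauchySeq_tendsto_of_complete hc
  exact ⟨A, mem_discGraph_iff.2 ⟨p, hp, hA⟩⟩

theorem mul_aeval_mem_adjoin {A : Type*} [Ring A] [Algebra ℂ A] (x : A) (q : ℂ[X]) :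
    x * aeval x q ∈ NonUnitalAlgebra.adjoin ℂ {x} := by
  have hx : x ∈ NonUnitalAlgebra.adjoin ℂ {x} := NonUnitalAlgebra.self_mem_adjoin_singleton ℂ x
  induction q using Polynomial.induction_on' with
  | add p q hp hq => rw [map_add, mul_add]; exact add_mem hp hq
  | monomial n a =>
    rw [aeval_monomial, Algebra.algebraMap_eq_smul_one, smul_mul_assoc, one_mul, mul_smul_comm]
    refine SMulMemClass.smul_mem _ ?_
    induction n with
    | zero => simp
    | succ n ih => rw [pow_succ, ← mul_assoc]; exact mul_mem ih hx

/-- For a polynomial, `p(x + a) - p(a)` has no constant term in `x`, so it is `x` times a polynomial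
in `x`; the rest is closure. -/
theorem sub_smul_one_mem_oa {x : H →L[ℂ] H} {a c : ℂ} {r : ℝ} (ha : a ∈ Metric.closedBall c r)
    {f : C(Metric.closedBall c r, ℂ)} {A : H →L[ℂ] H}
    (hA : (f, A) ∈ discGraph (x + a • 1) c r) : A - f ⟨a, ha⟩ • 1 ∈ oa x := by
  obtain ⟨p, h1, h2⟩ := mem_discGraph_iff.1 hA
  have h3 : Tendsto (fun n => aeval (x + a • 1) (p n) -
      (toContinuousMapOnAlgHom (Metric.closedBall c r) (p n) ⟨a, ha⟩) • (1 : H →L[ℂ] H))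
      atTop (𝓝 (A - f ⟨a, ha⟩ • 1)) := by
    refine h2.sub (Tendsto.smul_const ?_ _)
    exact ((continuous_eval_const (F := C(Metric.closedBall c r, ℂ)) (⟨a, ha⟩ : Metric.closedBall c r)).tendsto f).comp h1
  refine (NonUnitalSubalgebra.isClosed_topologicalClosure _).mem_of_tendsto h3 (.of_forall fun n => ?_)
  refine NonUnitalSubalgebra.le_topologicalClosure _ ?_
  change aeval (x + a • 1) (p n) - ((p n).eval a) • (1 : H →L[ℂ] H) ∈ _
  have h4 : aeval (x + a • 1) (p n) = aeval x ((p n).comp (Polynomial.X + C a)) := by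
    rw [aeval_comp]
    simp [Algebra.algebraMap_eq_smul_one]
  have h5 : aeval x ((p n).comp (Polynomial.X + C a)) - ((p n).eval a) • (1 : H →L[ℂ] H) =
      x * aeval x (((p n).comp (Polynomial.X + C a)).divX) := by
    have := congrArg (aeval x) (divX_mul_X_add ((p n).comp (Polynomial.X + C a)))
    rw [← this, coeff_zero_eq_eval_zero]
    simp only [map_add, map_mul, aeval_X, aeval_C, Algebra.algebraMap_eq_smul_one, eval_comp,
      eval_add, eval_X, eval_C, zero_add, add_sub_cancel_right]
    have hcm := (Commute.all (Polynomial.X : ℂ[X])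
      (((p n).comp (Polynomial.X + C a)).divX)).map (aeval x)
    rw [aeval_X] at hcm
    exact hcm.eq.symm
  rw [h4, h5]
  exact mul_aeval_mem_adjoin x _

end DiscCalculus

/-! ### Scalar estimates for fractional powers on the right half plane -/

section RightHalfPlane

/-- As `|w + s| ≥ Re w + s` and `α ≤ 1`, the derivative in `s` is dominated by that of `(Re w +
s)^α`, and real powers with exponent at most one are subadditive. -/
theorem norm_add_ofReal_cpow_sub_le {w : ℂ} (hw : 0 < w.re) {δ α : ℝ} (hδ : 0 ≤ δ) (h0 : 0 < α)
    (h1 : α ≤ 1) : ‖(w + δ) ^ (α : ℂ) - w ^ (α : ℂ)‖ ≤ δ ^ α := by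
  have hre : ∀ s : ℝ, 0 ≤ s → 0 < (w + s).re := fun s hs => by simp; linarith
  have hf : ∀ s : ℝ, 0 ≤ s → HasDerivAt (fun s : ℝ => (w + s) ^ (α : ℂ) - w ^ (α : ℂ))
      ((α : ℂ) * (w + s) ^ ((α : ℂ) - 1)) s := fun s hs => by
    have h2 : HasDerivAt (fun s : ℂ => w + s) 1 (s : ℂ) := (hasDerivAt_id _).const_add w
    simpa using ((h2.cpow_const (c := (α : ℂ)) (Or.inl (hre s hs))).sub_const
      (w ^ (α : ℂ))).comp_ofReal
  have hB : ∀ s : ℝ, 0 ≤ s → HasDerivAt (fun s : ℝ => (w.re + s) ^ α - w.re ^ α)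
      (α * (w.re + s) ^ (α - 1)) s := fun s hs => by
    have h2 : HasDerivAt (fun s : ℝ => w.re + s) 1 s := (hasDerivAt_id s).const_add _
    simpa using (h2.rpow_const (p := α) (Or.inl (by linarith))).sub_const (w.re ^ α)
  have key := image_norm_le_of_norm_deriv_right_le_deriv_boundary' (a := 0) (b := δ)
    (fun s hs => (hf s hs.1).continuousAt.continuousWithinAt)
    (fun s hs => (hf s hs.1).hasDerivWithinAt)
    (B := fun s : ℝ => (w.re + s) ^ α - w.re ^ α) (by simp)
    (fun s hs => (hB s hs.1).continuousAt.continuousWithinAt)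
    (fun s hs => (hB s hs.1).hasDerivWithinAt)
    (fun s hs => by
      rw [norm_mul, Complex.norm_real, Real.norm_of_nonneg h0.le,
        show (α : ℂ) - 1 = ((α - 1 : ℝ) : ℂ) by push_cast; rfl, Complex.norm_cpow_real]
      refine mul_le_mul_of_nonneg_left ?_ h0.le
      refine Real.rpow_le_rpow_of_nonpos (by linarith [hs.1]) ?_ (by linarith)
      simpa using Complex.re_le_norm (w + s))
    (Set.right_mem_Icc.2 hδ)
  refine key.trans ?_
  have := Real.rpow_add_le_add_rpow hw.le hδ h0.le h1
  linarith

theorem one_le_norm_one_add {w : ℂ} (hw : 0 < w.re) : 1 ≤ ‖1 + w‖ := by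
  have := Complex.re_le_norm (1 + w)
  simp at this
  linarith

theorem norm_le_norm_one_add {w : ℂ} (hw : 0 < w.re) : ‖w‖ ≤ ‖1 + w‖ := by
  rw [← sq_le_sq₀ (norm_nonneg _) (norm_nonneg _), ← Complex.normSq_eq_norm_sq,
    ← Complex.normSq_eq_norm_sq, Complex.normSq_apply, Complex.normSq_apply]
  simp
  nlinarith

theorem norm_cpow_div_le {w : ℂ} (hw : 0 < w.re) {δ α : ℝ} (hδ : 0 < δ) (h0 : 0 < α)
    (h1 : α ≤ 1) : ‖w ^ (α : ℂ) / (1 + δ * w)‖ ≤ δ ^ (-α) := by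
  have hw' : 0 < ((δ : ℂ) * w).re := by rw [Complex.re_ofReal_mul]; positivity
  have ha := one_le_norm_one_add hw'
  have hb := norm_le_norm_one_add hw'
  rw [norm_mul, Complex.norm_real, Real.norm_of_nonneg hδ.le] at hb
  rw [norm_div, Complex.norm_cpow_real, div_le_iff₀ (by linarith), Real.rpow_neg hδ.le,
    ← div_eq_inv_mul, le_div_iff₀ (by positivity), mul_comm,
    ← Real.mul_rpow hδ.le (norm_nonneg w)]
  rcases le_total (δ * ‖w‖) 1 with h | h
  · exact (Real.rpow_le_one (by positivity) h h0.le).trans ha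
  · refine le_trans ?_ hb
    simpa using Real.rpow_le_rpow_of_exponent_le h h1

theorem norm_exp_sub_one_le_mul_max (z : ℂ) :
    ‖Complex.exp z - 1‖ ≤ ‖z‖ * max 1 (Real.exp z.re) := by
  have h : ∀ t : ℝ, HasDerivAt (fun t : ℝ => Complex.exp (t * z)) (Complex.exp (t * z) * z) t := by
    intro t
    have h2 : HasDerivAt (fun t : ℝ => (t : ℂ) * z) z t := by
      simpa using (Complex.ofRealCLM.hasDerivAt (x := t)).mul_const z
    exact h2.cexp
  have := norm_image_sub_le_of_norm_deriv_le_segment_01' (C := ‖z‖ * max 1 (Real.exp z.re))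
    (fun t _ => (h t).hasDerivWithinAt) (fun t ht => by
      rw [norm_mul, mul_comm, Complex.norm_exp, Complex.re_ofReal_mul]
      refine mul_le_mul_of_nonneg_left ?_ (norm_nonneg z)
      rcases le_total z.re 0 with h | h
      · exact le_max_of_le_left (Real.exp_le_one_iff.2 (mul_nonpos_of_nonneg_of_nonpos ht.1 h))
      · exact le_max_of_le_right (Real.exp_le_exp.2 (mul_le_of_le_one_left h ht.2.le)))
  simpa using this

/-- Write `w^α = exp(α log w)`. The factor `w` absorbs the logarithm near `0`, and `(1 + w)^3`
absorbs the growth at infinity. -/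
theorem norm_cpow_sub_one_mul_div_le {w : ℂ} (hw : 0 < w.re) {α : ℝ} (h0 : 0 < α) (h1 : α ≤ 1) :
    ‖(w ^ (α : ℂ) - 1) * w / (1 + w) ^ 3‖ ≤ 3 * α := by
  have ha := one_le_norm_one_add hw
  have hb := norm_le_norm_one_add hw
  have hw0 : w ≠ 0 := by rintro rfl; simp at hw
  set N := ‖1 + w‖ with hN
  set ρ := ‖w‖ with hρ
  have hρ0 : 0 < ρ := norm_pos_iff.2 hw0
  have hlog : ‖Complex.log w‖ ≤ |Real.log ρ| + 2 := by
    refine (Complex.norm_le_abs_re_add_abs_im _).trans ?_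
    rw [Complex.log_re, Complex.log_im]
    have := Complex.abs_arg_le_pi_div_two_iff.2 hw.le
    have := Real.pi_lt_four
    linarith
  have hexp : Real.exp ((Complex.log w * α).re) ≤ max 1 ρ := by
    rw [mul_comm, Complex.re_ofReal_mul, Complex.log_re]
    rcases le_total ρ 1 with h | h
    · refine le_max_of_le_left (Real.exp_le_one_iff.2 ?_)
      exact mul_nonpos_of_nonneg_of_nonpos h0.le (Real.log_nonpos hρ0.le h)
    · refine le_max_of_le_right ?_
      rw [← Real.le_log_iff_exp_le hρ0]
      exact mul_le_of_le_one_left (Real.log_nonneg h) h1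
  have h2 : ‖w ^ (α : ℂ) - 1‖ ≤ α * (|Real.log ρ| + 2) * max 1 ρ := by
    rw [Complex.cpow_def_of_ne_zero hw0]
    refine (norm_exp_sub_one_le_mul_max _).trans ?_
    rw [norm_mul, Complex.norm_real, Real.norm_of_nonneg h0.le, mul_comm _ α]
    refine mul_le_mul ?_ (max_le (le_max_left _ _) hexp) (by positivity) (by positivity)
    exact mul_le_mul_of_nonneg_left hlog h0.le
  have h3 : |Real.log ρ| * max 1 ρ * ρ ≤ N ^ 3 := by
    rcases le_total ρ 1 with h | h
    · rw [max_eq_left h, mul_one, abs_of_nonpos (Real.log_nonpos hρ0.le h), ← Real.log_inv]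
      have h4 := Real.log_le_self (inv_nonneg.2 hρ0.le)
      calc Real.log ρ⁻¹ * ρ ≤ ρ⁻¹ * ρ := mul_le_mul_of_nonneg_right h4 hρ0.le
        _ = 1 := inv_mul_cancel₀ hρ0.ne'
        _ ≤ N ^ 3 := one_le_pow₀ ha
    · rw [max_eq_right h, abs_of_nonneg (Real.log_nonneg h)]
      calc Real.log ρ * ρ * ρ ≤ ρ * ρ * ρ := by
            have := Real.log_le_self hρ0.le
            gcongr
        _ = ρ ^ 3 := by ring
        _ ≤ N ^ 3 := by gcongr
  have h4 : max 1 ρ * ρ ≤ N ^ 3 := by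
    calc max 1 ρ * ρ ≤ N * N := mul_le_mul (max_le ha hb) hb hρ0.le (by linarith)
      _ = N ^ 2 := by ring
      _ ≤ N ^ 3 := pow_le_pow_right₀ ha (by norm_num)
  rw [norm_div, norm_mul, norm_pow, div_le_iff₀ (by positivity)]
  calc ‖w ^ (α : ℂ) - 1‖ * ρ ≤ α * (|Real.log ρ| + 2) * max 1 ρ * ρ := by gcongr
    _ = α * (|Real.log ρ| * max 1 ρ * ρ + 2 * (max 1 ρ * ρ)) := by ring
    _ ≤ α * (N ^ 3 + 2 * N ^ 3) := by gcongr
    _ = 3 * α * N ^ 3 := by ring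

theorem re_exp_mul_cpow_nonneg {w : ℂ} (hw : 0 < w.re) {α φ : ℝ} (h0 : 0 ≤ α)
    (hφ : |φ| ≤ Real.pi / 2 - α * (Real.pi / 2)) :
    0 ≤ (Complex.exp (φ * Complex.I) * w ^ (α : ℂ)).re := by
  have hw0 : w ≠ 0 := by rintro rfl; simp at hw
  rw [Complex.cpow_def_of_ne_zero hw0, ← Complex.exp_add, Complex.exp_re]
  refine mul_nonneg (Real.exp_pos _).le (Real.cos_nonneg_of_mem_Icc ?_)
  have h1 := Complex.abs_arg_le_pi_div_two_iff.2 hw.le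
  have h2 : |α * w.arg| ≤ α * (Real.pi / 2) := by
    rw [abs_mul, abs_of_nonneg h0]; gcongr
  have h3 : ((φ : ℂ) * Complex.I + Complex.log w * α).im = φ + α * w.arg := by
    simp [Complex.log_im, mul_comm]
  rw [h3]
  rw [abs_le] at h2 hφ
  constructor <;> linarith [h2.1, h2.2, hφ.1, hφ.2]

theorem abs_arg_le_of_re_exp_mul_nonneg {z : ℂ} {β : ℝ} (h0 : 0 < β) (hβ : β ≤ Real.pi / 2)
    (h : ∀ φ : ℝ, |φ| ≤ Real.pi / 2 - β → 0 ≤ (Complex.exp (φ * Complex.I) * z).re) :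
    |z.arg| ≤ β := by
  rcases eq_or_ne z 0 with rfl | hz
  · simpa using h0.le
  have hc : ∀ φ : ℝ, |φ| ≤ Real.pi / 2 - β → 0 ≤ Real.cos (φ + z.arg) := fun φ hφ => by
    have h1 := h φ hφ
    rw [← Complex.norm_mul_exp_arg_mul_I z, mul_left_comm, ← Complex.exp_add,
      Complex.re_ofReal_mul, ← add_mul, ← Complex.ofReal_add, Complex.exp_ofReal_mul_I_re] at h1
    exact nonneg_of_mul_nonneg_right h1 (norm_pos_iff.2 hz)
  have hd := hc 0 (by simpa using hβ)
  have hpi := Real.pi_pos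
  -- This keeps the extreme rotation below from passing the left half plane altogether: its angle
  -- stays under `3π/2`.
  have h2 : |z.arg| ≤ Real.pi / 2 := by
    by_contra! hlt
    rw [zero_add, ← Real.cos_abs] at hd
    have := Real.cos_neg_of_pi_div_two_lt_of_lt hlt (by linarith [Complex.abs_arg_le_pi z])
    linarith
  by_contra! hlt
  have key : 0 ≤ Real.cos (|z.arg| + (Real.pi / 2 - β)) := by
    rcases abs_cases z.arg with ⟨e, _⟩ | ⟨e, _⟩
    · rw [e, add_comm]
      exact hc _ (by rw [abs_of_nonneg (by linarith)])
    · rw [e, ← Real.cos_neg, neg_add, neg_neg, add_comm]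
      exact hc _ (by rw [abs_neg, abs_of_nonneg (by linarith)])
  have := Real.cos_neg_of_pi_div_two_lt_of_lt (x := |z.arg| + (Real.pi / 2 - β))
    (by linarith) (by linarith)
  linarith

theorem re_exp_mul_nonneg_of_abs_arg_le {z : ℂ} {β φ : ℝ} (hz : |z.arg| ≤ β)
    (hφ : |φ| ≤ Real.pi / 2 - β) : 0 ≤ (Complex.exp (φ * Complex.I) * z).re := by
  rw [← Complex.norm_mul_exp_arg_mul_I z, mul_left_comm, ← Complex.exp_add,
    Complex.re_ofReal_mul, ← add_mul, ← Complex.ofReal_add, Complex.exp_ofReal_mul_I_re]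
  refine mul_nonneg (norm_nonneg _) (Real.cos_nonneg_of_mem_Icc ?_)
  rw [abs_le] at hz hφ
  constructor <;> linarith [hz.1, hz.2, hφ.1, hφ.2]

end RightHalfPlane

/-! ### Uniqueness of sectorial roots -/

section Uniqueness

variable {H : Type*} [NormedAddCommGroup H] [InnerProductSpace ℂ H]

/-- The numerical range lies in the closed sector `|arg| ≤ β` (for `β ≤ π / 2`), expressed
through the rotations that keep the sector in the right half plane. -/
def IsSectorial (β : ℝ) (A : H →L[ℂ] H) : Prop :=
  ∀ (h : H) (φ : ℝ), |φ| ≤ Real.pi / 2 - β →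
    0 ≤ (Complex.exp (φ * Complex.I) * inner ℂ h (A h)).re

theorem IsSectorial.mono {β γ : ℝ} {A : H →L[ℂ] H} (hA : IsSectorial β A) (h : β ≤ γ) :
    IsSectorial γ A :=
  fun u φ hφ => hA u φ (by linarith)

theorem IsSectorial.re_inner_nonneg {β : ℝ} {A : H →L[ℂ] H} (hA : IsSectorial β A)
    (hβ : β ≤ Real.pi / 2) (h : H) : 0 ≤ (inner ℂ h (A h)).re := by
  simpa using hA h 0 (by simpa using hβ)

theorem IsSectorial.of_numericalRange {β : ℝ} {A : H →L[ℂ] H}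
    (hA : ∀ z ∈ numericalRange A, |z.arg| ≤ β) : IsSectorial β A := by
  intro h φ hφ
  rcases eq_or_ne h 0 with rfl | h0
  · simp
  have hn : ‖h‖ ≠ 0 := norm_ne_zero_iff.2 h0
  have hz := hA (inner ℂ ((‖h‖⁻¹ : ℂ) • h) (A ((‖h‖⁻¹ : ℂ) • h)))
    ⟨_, by rw [norm_smul]; simp [hn], rfl⟩
  have h1 := re_exp_mul_nonneg_of_abs_arg_le hz hφ
  have h2 : inner ℂ h (A h) =
      ((‖h‖ ^ 2 : ℝ) : ℂ) * inner ℂ ((‖h‖⁻¹ : ℂ) • h) (A ((‖h‖⁻¹ : ℂ) • h)) := by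
    have : (‖h‖ : ℂ) ≠ 0 := by exact_mod_cast hn
    rw [map_smul, inner_smul_left, inner_smul_right]
    simp only [map_inv₀, Complex.conj_ofReal, Complex.ofReal_pow]
    field_simp
  rw [h2, mul_left_comm, Complex.re_ofReal_mul]
  exact mul_nonneg (by positivity) h1

theorem IsSectorial.abs_arg_le {β : ℝ} {A : H →L[ℂ] H} (hA : IsSectorial β A) (h0 : 0 < β)
    (hβ : β ≤ Real.pi / 2) {z : ℂ} (hz : z ∈ numericalRange A) : |z.arg| ≤ β := by
  obtain ⟨h, -, rfl⟩ := hz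
  exact abs_arg_le_of_re_exp_mul_nonneg h0 hβ (hA h)

theorem isClosed_setOf_isSectorial (β : ℝ) : IsClosed {A : H →L[ℂ] H | IsSectorial β A} := by
  simp only [IsSectorial, Set.ofPred_forall]
  refine isClosed_iInter fun h => isClosed_iInter fun φ => isClosed_iInter fun _ => ?_
  exact isClosed_le (by fun_prop) (by fun_prop)

variable [CompleteSpace H]

/-- A positive operator `S*S` whose form vanishes at `h` kills `h`, because `‖S h‖² = 0`. -/
theorem add_star_apply_eq_zero {A : H →L[ℂ] H} (hA : ∀ h, 0 ≤ (inner ℂ h (A h)).re) {h : H}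
    (hh : (inner ℂ h (A h)).re = 0) : A h + star A h = 0 := by
  have hre : ∀ u : H, (inner ℂ u ((A + star A) u)).re = 2 * (inner ℂ u (A u)).re := fun u => by
    rw [add_apply, inner_add_right, ContinuousLinearMap.star_eq_adjoint,
      ContinuousLinearMap.adjoint_inner_right, Complex.add_re, ← inner_conj_symm (A u) u,
      Complex.conj_re]
    ring
  have hpos : 0 ≤ A + star A := by
    rw [ContinuousLinearMap.nonneg_iff_isPositive, ContinuousLinearMap.isPositive_def']
    refine ⟨IsSelfAdjoint.add_star_self A, fun u => ?_⟩
    rw [ContinuousLinearMap.reApplyInnerSelf_apply, ← inner_conj_symm, RCLike.conj_re]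
    have := hre u
    have := hA u
    simp only [RCLike.re_to_complex]
    linarith
  obtain ⟨S, hS⟩ := CStarAlgebra.nonneg_iff_eq_star_mul_self.1 hpos
  have h1 := hre h
  rw [hh, mul_zero, hS, mul_apply_eq_comp, ContinuousLinearMap.star_eq_adjoint,
    ContinuousLinearMap.adjoint_inner_right] at h1
  have h2 : ‖S h‖ ^ 2 = 0 := (norm_sq_eq_re_inner (𝕜 := ℂ) (S h)).trans h1
  have h3 : S h = 0 := by simpa using h2
  rw [← add_apply, hS, mul_apply_eq_comp, h3, map_zero]

theorem star_apply_eq_zero {A : H →L[ℂ] H} (hA : ∀ h, 0 ≤ (inner ℂ h (A h)).re) {h : H}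
    (hh : A h = 0) : star A h = 0 := by
  simpa [hh] using add_star_apply_eq_zero hA (h := h) (by simp [hh])

theorem star_mul_eq_zero_of_mul_eq_zero {A B : H →L[ℂ] H} (hA : ∀ h, 0 ≤ (inner ℂ h (A h)).re)
    (hB : A * B = 0) : star A * B = 0 := by
  ext h
  exact star_apply_eq_zero hA (by simpa using congrArg (fun T : H →L[ℂ] H => T h) hB)

/-- The kernel of an accretive `A` lies in that of `A*`, so `A*AB = 0` and the C*-identity applies
to `AB`. -/
theorem mul_eq_zero_of_mul_mul_eq_zero {A B : H →L[ℂ] H} (hA : ∀ h, 0 ≤ (inner ℂ h (A h)).re)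
    (hB : A * (A * B) = 0) : A * B = 0 := by
  have h1 := star_mul_eq_zero_of_mul_eq_zero hA hB
  have h2 : star (A * B) * (A * B) = 0 := by
    rw [star_mul, mul_assoc, h1, mul_zero]
  exact CStarRing.star_mul_self_eq_zero_iff _ |>.1 h2

theorem mul_eq_zero_of_pow_mul_eq_zero {A B : H →L[ℂ] H} (hA : ∀ h, 0 ≤ (inner ℂ h (A h)).re)
    {n : ℕ} (hn : n ≠ 0) (hB : A ^ n * B = 0) : A * B = 0 := by
  induction n with
  | zero => exact absurd rfl hn
  | succ n ih =>
    rcases eq_or_ne n 0 with rfl | h0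
    · simpa using hB
    obtain ⟨k, rfl⟩ := Nat.exists_eq_succ_of_ne_zero h0
    refine ih h0 ?_
    rw [Nat.succ_eq_add_one, pow_succ', mul_assoc] at hB ⊢
    rw [pow_succ', mul_assoc] at hB
    exact mul_eq_zero_of_mul_mul_eq_zero hA hB

/-- If three neighbouring rotations of `z` are accretive and the form of the middle one vanishes
at `h`, then `z h = 0`. -/
theorem apply_eq_zero_of_rotations {z : H →L[ℂ] H} {ψ η : ℝ} (hη : Real.sin η ≠ 0)
    (h0 : ∀ h, 0 ≤ (Complex.exp (ψ * Complex.I) * inner ℂ h (z h)).re)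
    (h1 : ∀ h, 0 ≤ (Complex.exp ((ψ + η : ℝ) * Complex.I) * inner ℂ h (z h)).re)
    (h2 : ∀ h, 0 ≤ (Complex.exp ((ψ - η : ℝ) * Complex.I) * inner ℂ h (z h)).re)
    {h : H} (hh : (Complex.exp (ψ * Complex.I) * inner ℂ h (z h)).re = 0) : z h = 0 := by
  have e1 : Complex.exp ((ψ + η : ℝ) * Complex.I) =
      Complex.exp (ψ * Complex.I) * Complex.exp (η * Complex.I) := by
    rw [← Complex.exp_add]; push_cast; ring_nf
  have e2 : Complex.exp ((ψ - η : ℝ) * Complex.I) =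
      Complex.exp (ψ * Complex.I) * Complex.exp (-η * Complex.I) := by
    rw [← Complex.exp_add]; push_cast; ring_nf
  set c := Complex.exp (ψ * Complex.I) with hc
  set d := Complex.exp (η * Complex.I) with hd
  have hdim : d.im = Real.sin η := Complex.exp_ofReal_mul_I_im η
  have hdre : d.re = Real.cos η := Complex.exp_ofReal_mul_I_re η
  have hd' : Complex.exp (-η * Complex.I) = star d := by
    rw [hd, Complex.star_def, ← Complex.exp_conj]; simp
  rw [e1] at h1
  rw [e2, hd'] at h2
  -- The value is purely imaginary; rotating it by `η` and by `-η` gives opposite real parts, both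
  -- nonnegative.
  have him : (c * inner ℂ h (z h)).im = 0 := by
    have a1 := h1 h
    have a2 := h2 h
    rw [mul_right_comm, Complex.mul_re, hh] at a1 a2
    simp only [Complex.star_def, Complex.conj_im, zero_mul, zero_sub, mul_neg, neg_neg] at a1 a2
    rw [hdim] at a1 a2
    have : (c * inner ℂ h (z h)).im * Real.sin η = 0 := by linarith
    exact (mul_eq_zero.1 this).resolve_right hη
  have hre : (c * d * inner ℂ h (z h)).re = 0 := by
    rw [mul_right_comm, Complex.mul_re, hh, him]; simp
  have k0 := add_star_apply_eq_zero (A := c • z) (by simpa [inner_smul_right] using h0)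
    (h := h) (by simpa [inner_smul_right] using hh)
  have k1 := add_star_apply_eq_zero (A := (c * d) • z) (by simpa [inner_smul_right] using h1)
    (h := h) (by simpa [inner_smul_right] using hre)
  simp only [star_smul, smul_apply, star_mul] at k0 k1
  -- `k0` and `k1` are two linear equations in `z h` and `star z h`; the second vector is
  -- eliminated.
  have k2 : c • ((d - star d) • z h) = 0 := by
    have : c • ((d - star d) • z h) = ((c * d) • z h + (star d * star c) • star z h) -
        star d • (c • z h + star c • star z h) := by module
    rw [this, k1, k0]; simp
  have hc0 : c ≠ 0 := Complex.exp_ne_zero _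
  have hdd : d - star d ≠ 0 := by
    intro h3
    have := congrArg Complex.im h3
    simp only [Complex.star_def, Complex.sub_im, Complex.conj_im, Complex.zero_im, hdim] at this
    exact hη (by linarith)
  exact (smul_eq_zero.1 ((smul_eq_zero.1 k2).resolve_left hc0)).resolve_left hdd

/-- On the range of `Q` one has `y = ζz` with `ζ ≠ 1`. Rotating `y` by `-ψ` and `z` by `ψ` makes
both forms accretive with sum zero, so the form of `z` rotated by `ψ` vanishes there. The narrower
sector of `z` leaves room for the neighbouring rotations `ψ ± π/(2m)`. -/
theorem mul_eq_zero_of_sub_root_smul_mul_eq_zero {y z Q : H →L[ℂ] H} {m k : ℕ} (hk : 0 < k)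
    (hkm : k < m) (hy : IsSectorial (Real.pi / m) y) (hz : IsSectorial (Real.pi / (2 * m)) z)
    (hQ : (y - Complex.exp (2 * Real.pi * Complex.I * (k / m)) • z) * Q = 0) : z * Q = 0 := by
  have hm : (0 : ℝ) < m := by exact_mod_cast hk.trans hkm
  have hpi := Real.pi_pos
  -- Chosen so that `e^{-iψ} ζ = -e^{iψ}`; the bounds `1 ≤ k ≤ m - 1` are exactly what keeps `ψ`
  -- admissible for the sector `π/m`.
  set ψ : ℝ := Real.pi * k / m - Real.pi / 2 with hψ
  have hψle : |ψ| ≤ Real.pi / 2 - Real.pi / m := by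
    have h1 : Real.pi / m ≤ Real.pi * k / m := by
      have : (1 : ℝ) ≤ k := by exact_mod_cast hk
      gcongr; nlinarith
    have h2 : Real.pi * k / m ≤ Real.pi - Real.pi / m := by
      have : (k : ℝ) + 1 ≤ m := by exact_mod_cast hkm
      rw [div_le_iff₀ hm, sub_mul, div_mul_cancel₀ _ hm.ne']
      nlinarith
    rw [abs_le]; constructor <;> rw [hψ] <;> linarith
  have hη : Real.pi / m = Real.pi / (2 * m) + Real.pi / (2 * m) := by field_simp; norm_num
  have hη0 : 0 < Real.pi / (2 * m) := by positivity
  have hroot : Complex.exp (-ψ * Complex.I) * Complex.exp (2 * Real.pi * Complex.I * (k / m)) =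
      -Complex.exp (ψ * Complex.I) := by
    rw [← Complex.exp_add, ← neg_eq_iff_eq_neg, ← mul_neg_one, ← Complex.exp_pi_mul_I,
      ← Complex.exp_add]
    have e : -(ψ : ℂ) * Complex.I + 2 * Real.pi * Complex.I * (k / m) + Real.pi * Complex.I =
        ψ * Complex.I + 2 * Real.pi * Complex.I := by
      rw [hψ]; push_cast; ring
    rw [e, Complex.exp_periodic]
  ext h
  have hh : (y - Complex.exp (2 * Real.pi * Complex.I * (k / m)) • z) (Q h) = 0 := by
    simpa using congrArg (fun T : H →L[ℂ] H => T h) hQ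
  have hab : |ψ + Real.pi / (2 * m)| ≤ Real.pi / 2 - Real.pi / (2 * m) := by
    refine (abs_add_le _ _).trans ?_
    rw [abs_of_pos hη0]; linarith
  have hab' : |ψ - Real.pi / (2 * m)| ≤ Real.pi / 2 - Real.pi / (2 * m) := by
    refine (abs_sub _ _).trans ?_
    rw [abs_of_pos hη0]; linarith
  refine apply_eq_zero_of_rotations (ψ := ψ) (η := Real.pi / (2 * m)) ?_
    (fun u => hz u ψ (by linarith)) (fun u => hz u _ hab) (fun u => hz u _ hab') ?_
  · refine (Real.sin_pos_of_pos_of_lt_pi hη0 ?_).ne'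
    have h1 : Real.pi / (2 * m) ≤ Real.pi / 2 := by linarith [abs_nonneg ψ]
    linarith
  · have hy' := hy (Q h) (-ψ) (by rwa [abs_neg])
    have hz' := hz (Q h) ψ (by linarith)
    have h3 : Complex.exp ((-ψ : ℝ) * Complex.I) * inner ℂ (Q h) (y (Q h)) +
        Complex.exp (ψ * Complex.I) * inner ℂ (Q h) (z (Q h)) = 0 := by
      have h4 : y (Q h) = Complex.exp (2 * Real.pi * Complex.I * (k / m)) • z (Q h) := by
        rw [sub_apply, sub_eq_zero] at hh
        simpa using hh
      rw [h4, inner_smul_right, ← mul_assoc]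
      push_cast
      rw [hroot]; ring
    have h5 := congrArg Complex.re h3
    rw [Complex.add_re, Complex.zero_re] at h5
    have h6 : (Complex.exp (ψ * Complex.I) * inner ℂ (Q h) (z (Q h))).re = 0 :=
      le_antisymm (by linarith) hz'
    exact h6

theorem pow_sub_pow_eq_prod_nthRoots {S : Type*} [CommRing S] [Algebra ℂ S] (a b : S) {m : ℕ}
    (hm : 0 < m) : a ^ m - b ^ m =
      ∏ ζ ∈ Polynomial.nthRootsFinset m (1 : ℂ), (a - algebraMap ℂ S ζ * b) := by
  -- `S` may have zero divisors, so the factorization is proved for scalars, lifted to a polynomial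
  -- identity, and specialized.
  have h : (MvPolynomial.X 0 ^ m - MvPolynomial.X 1 ^ m : MvPolynomial (Fin 2) ℂ) =
      ∏ ζ ∈ Polynomial.nthRootsFinset m (1 : ℂ),
        (MvPolynomial.X 0 - MvPolynomial.C ζ * MvPolynomial.X 1) := by
    refine MvPolynomial.funext fun v => ?_
    simpa [map_prod] using
      (Complex.isPrimitiveRoot_exp m hm.ne').pow_sub_pow_eq_prod_sub_mul (v 0) (v 1) hm
  simpa [map_prod] using congrArg (MvPolynomial.aeval ![a, b]) h

theorem pow_card_mul_eq_zero_of_prod_mul_eq_zero {S ι : Type*} [CommRing S] [DecidableEq ι]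
    (s : Finset ι) (f : ι → S) (b : S) (hs : ∀ i ∈ s, ∀ Q, f i * Q = 0 → b * Q = 0) (Q : S)
    (hQ : (∏ i ∈ s, f i) * Q = 0) : b ^ s.card * Q = 0 := by
  induction s using Finset.induction_on generalizing Q with
  | empty => simpa using hQ
  | insert i s hi ih =>
    rw [Finset.prod_insert hi, mul_assoc] at hQ
    have h1 := hs i (Finset.mem_insert_self i s) _ hQ
    rw [Finset.card_insert_of_notMem hi, pow_succ, mul_assoc]
    refine ih (fun j hj => hs j (Finset.mem_insert_of_mem hj)) _ ?_
    rw [← h1]; ring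

-- In the commutative algebra generated by `y` and `z`, the `m - 1` factors `y - ζz` with `ζ ≠ 1`
-- are traded one by one for `z`.
open scoped IsMulCommutative in
theorem sub_mul_pow_eq_zero_of_pow_eq_pow {y z : H →L[ℂ] H} {m : ℕ} (hm : 0 < m)
    (hyz : Commute y z) (hpow : y ^ m = z ^ m) (hy : IsSectorial (Real.pi / m) y)
    (hz : IsSectorial (Real.pi / (2 * m)) z) : z ^ (m - 1) * (y - z) = 0 := by
  classical
  have : IsMulCommutative (Algebra.adjoin ℂ {y, z}) := Algebra.isMulCommutative_adjoin ℂ (by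
    rintro a (rfl | rfl) b (rfl | rfl)
    exacts [rfl, hyz.eq, hyz.eq.symm, rfl])
  let a : Algebra.adjoin ℂ {y, z} := ⟨y, Algebra.subset_adjoin (by simp)⟩
  let b : Algebra.adjoin ℂ {y, z} := ⟨z, Algebra.subset_adjoin (by simp)⟩
  have hab : a ^ m - b ^ m = 0 := Subtype.ext (by
    change y ^ m - z ^ m = 0
    rw [hpow, sub_self])
  rw [pow_sub_pow_eq_prod_nthRoots a b hm] at hab
  have h1 : (1 : ℂ) ∈ Polynomial.nthRootsFinset m (1 : ℂ) := by
    rw [Polynomial.mem_nthRootsFinset hm]; simp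
  rw [← Finset.prod_erase_mul _ _ h1] at hab
  have key := pow_card_mul_eq_zero_of_prod_mul_eq_zero _ _ b ?_ _ hab
  · rw [Finset.card_erase_of_mem h1, (Complex.isPrimitiveRoot_exp m hm.ne').card_nthRootsFinset,
      map_one, one_mul] at key
    exact congrArg Subtype.val key
  · intro ζ hζ Q hQ
    have : NeZero m := ⟨hm.ne'⟩
    rw [Finset.mem_erase, Polynomial.mem_nthRootsFinset hm] at hζ
    obtain ⟨k, hk, rfl⟩ := (Complex.isPrimitiveRoot_exp m hm.ne').eq_pow_of_pow_eq_one hζ.2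
    have hk0 : 0 < k := Nat.pos_of_ne_zero (by rintro rfl; simp at hζ)
    rw [← Complex.exp_nat_mul, mul_div_left_comm] at hQ
    have hQ' : (y - Complex.exp (2 * Real.pi * Complex.I * (k / m)) • z) * (Q : H →L[ℂ] H) = 0 := by
      have := congrArg Subtype.val hQ
      change (y - (algebraMap ℂ (H →L[ℂ] H) _) * z) * (Q : H →L[ℂ] H) = 0 at this
      rwa [Algebra.algebraMap_eq_smul_one, smul_mul_assoc, one_mul] at this
    exact Subtype.ext (mul_eq_zero_of_sub_root_smul_mul_eq_zero hk0 hk hy hz hQ')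

/-- Lowering powers gives `z(y - z) = 0`, hence `y^k z = z^(k+1)` and then `y(y - z) = 0`. Both `y*`
and `z*` therefore annihilate `y - z`, so `(y - z)*(y - z) = 0`. -/
theorem eq_of_pow_eq_pow_of_isSectorial {y z : H →L[ℂ] H} {m : ℕ} (hm : 0 < m)
    (hyz : Commute y z) (hpow : y ^ m = z ^ m) (hy : IsSectorial (Real.pi / m) y)
    (hz : IsSectorial (Real.pi / (2 * m)) z) : y = z := by
  obtain rfl | hm2 : m = 1 ∨ 2 ≤ m := by lia
  · simpa using hpow
  have hm' : (2 : ℝ) ≤ m := by exact_mod_cast hm2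
  have hpi := Real.pi_pos
  have hya := hy.re_inner_nonneg (by gcongr)
  have hza := hz.re_inner_nonneg (by gcongr; linarith)
  have h1 := mul_eq_zero_of_pow_mul_eq_zero hza (by lia)
    (sub_mul_pow_eq_zero_of_pow_eq_pow hm hyz hpow hy hz)
  have h2 : ∀ k : ℕ, y ^ k * z = z ^ k * z := by
    intro k
    induction k with
    | zero => rfl
    | succ k ih =>
      have h3 : z * y = z * z := by rwa [mul_sub, sub_eq_zero] at h1
      rw [pow_succ, mul_assoc, hyz.eq, h3, ← mul_assoc, ih, pow_succ]
  have h3 : y ^ (m - 1) * (y - z) = 0 := by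
    rw [mul_sub, h2, ← pow_succ, ← pow_succ, Nat.sub_add_cancel hm, hpow, sub_self]
  have h4 := mul_eq_zero_of_pow_mul_eq_zero hya (by lia) h3
  have h5 : star (y - z) * (y - z) = 0 := by
    rw [star_sub, sub_mul, star_mul_eq_zero_of_mul_eq_zero hya h4,
      star_mul_eq_zero_of_mul_eq_zero hza h1, sub_zero]
  exact sub_eq_zero.1 ((CStarRing.star_mul_self_eq_zero_iff _).1 h5)

end Uniqueness

/-! ### Construction of the roots -/

section Roots

open Polynomial

variable {H : Type*} [NormedAddCommGroup H] [InnerProductSpace ℂ H]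

theorem commute_of_mem_oa {x z a : H →L[ℂ] H} (hz : Commute z x) (ha : a ∈ oa x) :
    Commute z a := by
  have hcl : IsClosed {a : H →L[ℂ] H | z * a = a * z} := isClosed_eq (by fun_prop) (by fun_prop)
  have hsub : ((NonUnitalAlgebra.adjoin ℂ {x} : NonUnitalSubalgebra ℂ (H →L[ℂ] H)) :
      Set (H →L[ℂ] H)) ⊆ {a | z * a = a * z} := by
    intro b hb
    change Commute z b
    induction hb using NonUnitalAlgebra.adjoin_induction with
    | mem b hb => rw [Set.mem_singleton_iff.1 hb]; exact hz
    | add a b _ _ ha hb => exact ha.add_right hb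
    | zero => exact Commute.zero_right z
    | mul a b _ _ ha hb => exact ha.mul_right hb
    | smul r a _ ha => exact ha.smul_right r
  exact closure_minimal hsub hcl ha

theorem commute_of_pow_eq_add_smul_one {x y : H →L[ℂ] H} {m : ℕ} {a : ℂ}
    (h : y ^ m = x + a • 1) : Commute y x := by
  have h1 : Commute y (y ^ m - a • 1) :=
    ((Commute.refl y).pow_right m).sub_right ((Commute.one_right y).smul_right a)
  rwa [h, add_sub_cancel_right] at h1

/-- Expanding the square gives `‖X - c‖² ≤ ‖X‖² - 2cε + c²`. The centre `c` satisfies `cε = ‖X‖² +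
ε²`, which puts this below `(c - ε/2)²`. -/
theorem norm_sub_smul_one_le {X : H →L[ℂ] H} {ε : ℝ} (hε : 0 < ε)
    (hX : ∀ h, ε * ‖h‖ ^ 2 ≤ (inner ℂ h (X h)).re) :
    ‖X - ((‖X‖ ^ 2 / ε + ε : ℝ) : ℂ) • 1‖ ≤ ‖X‖ ^ 2 / ε + ε / 2 := by
  set c := ‖X‖ ^ 2 / ε + ε with hc
  have hcε : c * ε = ‖X‖ ^ 2 + ε ^ 2 := by rw [hc]; field_simp
  have hc0 : 0 < c := by positivity
  refine ContinuousLinearMap.opNorm_le_bound _ (by positivity) fun h => ?_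
  refine le_of_sq_le_sq ?_ (by positivity)
  have h1 : ‖(X - (c : ℂ) • 1) h‖ ^ 2 =
      ‖X h‖ ^ 2 - 2 * (c * (inner ℂ h (X h)).re) + c ^ 2 * ‖h‖ ^ 2 := by
    have e : (X - (c : ℂ) • 1) h = X h - (c : ℂ) • h := by simp
    have e' : RCLike.re (inner ℂ (X h) ((c : ℂ) • h)) = c * (inner ℂ h (X h)).re := by
      rw [inner_smul_right, RCLike.re_to_complex, Complex.re_ofReal_mul,
        ← inner_conj_symm (X h) h, Complex.conj_re]
    rw [e, @norm_sub_sq ℂ, e', norm_smul, Complex.norm_real, mul_pow, Real.norm_eq_abs, sq_abs]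
  have h2 : ‖X h‖ ^ 2 ≤ ‖X‖ ^ 2 * ‖h‖ ^ 2 := by
    rw [← mul_pow]; gcongr; exact X.le_opNorm h
  have h3 : c * (ε * ‖h‖ ^ 2) ≤ c * (inner ℂ h (X h)).re :=
    mul_le_mul_of_nonneg_left (hX h) hc0.le
  have h4 : ‖X‖ ^ 2 / ε + ε / 2 = c - ε / 2 := by rw [hc]; ring
  rw [h1, h4]
  have h5 : ((c - ε / 2) * ‖h‖) ^ 2 = (c ^ 2 - c * ε + ε ^ 2 / 4) * ‖h‖ ^ 2 := by ring
  rw [h5, hcε]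
  have h6 : c * (ε * ‖h‖ ^ 2) = (‖X‖ ^ 2 + ε ^ 2) * ‖h‖ ^ 2 := by rw [← hcε]; ring
  nlinarith [sq_nonneg ‖h‖, mul_nonneg (sq_nonneg ε) (sq_nonneg ‖h‖)]

theorem re_pos_of_mem_ball {c : ℝ} {w : ℂ} (hw : w ∈ Metric.ball (c : ℂ) c) : 0 < w.re := by
  have h1 := (Complex.abs_re_le_norm _).trans_lt (mem_ball_iff_norm.1 hw)
  have h2 := (abs_lt.1 h1).1
  simp at h2
  linarith

/-- Restriction to a disc of a function holomorphic on the right half plane. -/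
noncomputable def discRestrict {c r : ℝ} (hrc : r < c) (f : ℂ → ℂ)
    (hf : DifferentiableOn ℂ f {w | 0 < w.re}) : C(Metric.closedBall (c : ℂ) r, ℂ) :=
  ⟨fun w => f w, continuousOn_iff_continuous_domRestrict.1 (hf.continuousOn.mono fun _ hw =>
    re_pos_of_mem_ball (Metric.closedBall_subset_ball hrc hw))⟩

theorem norm_discRestrict_le {c r : ℝ} (hrc : r < c) {f : ℂ → ℂ}
    (hf : DifferentiableOn ℂ f {w | 0 < w.re}) {M : ℝ} (hM : 0 ≤ M)
    (h : ∀ w : ℂ, 0 < w.re → ‖f w‖ ≤ M) : ‖discRestrict hrc f hf‖ ≤ M :=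
  (ContinuousMap.norm_le _ hM).2 fun w =>
    h w (re_pos_of_mem_ball (Metric.closedBall_subset_ball hrc w.2))

theorem differentiableOn_cpow_halfPlane (α : ℂ) {δ : ℝ} (hδ : 0 ≤ δ) :
    DifferentiableOn ℂ (fun w : ℂ => (w + δ) ^ α) {w | 0 < w.re} := by
  intro w hw
  refine DifferentiableWithinAt.cpow (by fun_prop) (by fun_prop) (Or.inl ?_)
  have : 0 < w.re := hw
  simp only [Complex.add_re, Complex.ofReal_re]
  linarith

variable [CompleteSpace H]

theorem exists_discRestrict_mem_discGraph {X : H →L[ℂ] H} {c r : ℝ} (hrc : r < c)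
    (hr : ‖X - (c : ℂ) • 1‖ < r) (f : ℂ → ℂ) (hf : DifferentiableOn ℂ f {w | 0 < w.re}) :
    ∃ A, (discRestrict hrc f hf, A) ∈ discGraph X c r :=
  exists_mem_discGraph hr hrc (hf.mono fun _ hw => re_pos_of_mem_ball hw) _ fun _ => rfl

/-- A root of `X + δ` obtained from the functional calculus of `X`. -/
theorem exists_root_mem_discGraph {X : H →L[ℂ] H} {c r δ : ℝ} (hrc : r < c)
    (hr : ‖X - (c : ℂ) • 1‖ < r) (hδ : 0 ≤ δ) {m : ℕ} (hm : 0 < m) :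
    ∃ y, (discRestrict hrc _ (differentiableOn_cpow_halfPlane ((m : ℝ)⁻¹ : ℝ) hδ), y) ∈
        discGraph X c r ∧ y ^ m = X + (δ : ℂ) • 1 ∧ IsSectorial (Real.pi / (2 * m)) y := by
  obtain ⟨y, hy⟩ := exists_discRestrict_mem_discGraph hrc hr _
    (differentiableOn_cpow_halfPlane ((m : ℝ)⁻¹ : ℝ) hδ)
  have hm0 : (m : ℝ) ≠ 0 := by exact_mod_cast hm.ne'
  refine ⟨y, hy, ?_, ?_⟩
  · refine eq_of_mem_discGraph hr (pow_mem hy m) ?_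
    have h1 := polynomial_mem_discGraph X c r (Polynomial.X + C (δ : ℂ))
    have h2 : toContinuousMapOnAlgHom (Metric.closedBall (c : ℂ) r) (Polynomial.X + C (δ : ℂ)) =
        discRestrict hrc _ (differentiableOn_cpow_halfPlane ((m : ℝ)⁻¹ : ℝ) hδ) ^ m := by
      ext w
      change (Polynomial.X + C (δ : ℂ)).eval (w : ℂ) =
        (((w : ℂ) + δ) ^ (((m : ℝ)⁻¹ : ℝ) : ℂ)) ^ m
      simp [Complex.cpow_nat_inv_pow _ hm.ne']
    rw [h2] at h1
    simpa [Algebra.algebraMap_eq_smul_one] using h1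
  · intro h φ hφ
    have h1 := (discGraph X c r).smul_mem hy (Complex.exp (φ * Complex.I))
    have h2 := re_inner_nonneg_of_mem_discGraph hr h1 (fun w => ?_) h
    · simpa [inner_smul_right] using h2
    · refine re_exp_mul_cpow_nonneg (w := (w : ℂ) + δ) ?_ (by positivity) (hφ.trans_eq ?_)
      · have := re_pos_of_mem_ball (Metric.closedBall_subset_ball hrc w.2)
        simp only [Complex.add_re, Complex.ofReal_re]
        linarith
      · field_simp

/-- The unbounded `w^α` is split as `w^α / (1 + δw)` times `1 + δw`, giving a bound independent of
the disc. -/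
theorem norm_root_le {X y : H →L[ℂ] H} {c r α δ : ℝ} (hrc : r < c) (hr : ‖X - (c : ℂ) • 1‖ < r)
    (h0 : 0 < α) (h1 : α ≤ 1) (hδ : 0 < δ)
    (hy : (discRestrict hrc _ (differentiableOn_cpow_halfPlane α le_rfl), y) ∈ discGraph X c r) :
    ‖y‖ ≤ δ ^ (-α) * (1 + δ * ‖X‖) := by
  have hne : ∀ w : ℂ, 0 < w.re → 1 + δ * w ≠ 0 := fun w hw h => by
    have h2 := congrArg Complex.re h
    simp at h2
    nlinarith
  have hg : DifferentiableOn ℂ (fun w : ℂ => w ^ (α : ℂ) / (1 + δ * w)) {w | 0 < w.re} := by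
    refine DifferentiableOn.div ?_ (by fun_prop) fun w hw => hne w hw
    simpa using differentiableOn_cpow_halfPlane (α : ℂ) le_rfl
  obtain ⟨B, hB⟩ := exists_discRestrict_mem_discGraph hrc hr _ hg
  have hBn : ‖B‖ ≤ δ ^ (-α) := (norm_le_of_mem_discGraph hr hB).trans
    (norm_discRestrict_le hrc hg (by positivity) fun w hw => norm_cpow_div_le hw hδ h0 h1)
  have hp := polynomial_mem_discGraph X c r (1 + C (δ : ℂ) * Polynomial.X)
  have hmul := mul_mem hB hp
  have e : discRestrict hrc _ hg * toContinuousMapOnAlgHom (Metric.closedBall (c : ℂ) r)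
      (1 + C (δ : ℂ) * Polynomial.X) =
      discRestrict hrc _ (differentiableOn_cpow_halfPlane (α : ℂ) le_rfl) := by
    ext w
    have hw := hne w (re_pos_of_mem_ball (Metric.closedBall_subset_ball hrc w.2))
    change (w : ℂ) ^ (α : ℂ) / (1 + δ * (w : ℂ)) * (1 + C (δ : ℂ) * Polynomial.X).eval (w : ℂ) =
      ((w : ℂ) + (0 : ℝ)) ^ (α : ℂ)
    simp only [eval_add, eval_one, eval_mul, eval_C, eval_X, Complex.ofReal_zero, add_zero]
    exact div_mul_cancel₀ _ hw
  rw [Prod.mk_mul_mk, e] at hmul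
  rw [eq_of_mem_discGraph hr hy hmul]
  refine (norm_mul_le _ _).trans (mul_le_mul hBn ?_ (norm_nonneg _) (by positivity))
  have e2 : aeval X (1 + C (δ : ℂ) * Polynomial.X) = 1 + (δ : ℂ) • X := by
    simp [Algebra.algebraMap_eq_smul_one]
  rw [e2]
  refine (norm_add_le _ _).trans (add_le_add ContinuousLinearMap.norm_id_le ?_)
  rw [norm_smul, Complex.norm_real, Real.norm_of_nonneg hδ.le]

theorem norm_root_sub_one_mul_le {X y : H →L[ℂ] H} {c r α : ℝ} (hrc : r < c)
    (hr : ‖X - (c : ℂ) • 1‖ < r) (h0 : 0 < α) (h1 : α ≤ 1)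
    (hy : (discRestrict hrc _ (differentiableOn_cpow_halfPlane α le_rfl), y) ∈ discGraph X c r) :
    ‖(y - 1) * X‖ ≤ 3 * α * ‖1 + X‖ ^ 3 := by
  have hne : ∀ w : ℂ, 0 < w.re → (1 + w) ^ 3 ≠ 0 := fun w hw h => by
    have h2 := congrArg Complex.re (pow_eq_zero_iff (three_ne_zero) |>.1 h)
    simp at h2
    linarith
  have hg : DifferentiableOn ℂ (fun w : ℂ => (w ^ (α : ℂ) - 1) * w / (1 + w) ^ 3)
      {w | 0 < w.re} := by
    have := differentiableOn_cpow_halfPlane (α : ℂ) le_rfl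
    simp only [Complex.ofReal_zero, add_zero] at this
    exact DifferentiableOn.div (by fun_prop) (by fun_prop) fun w hw => hne w hw
  obtain ⟨B, hB⟩ := exists_discRestrict_mem_discGraph hrc hr _ hg
  have hBn : ‖B‖ ≤ 3 * α := (norm_le_of_mem_discGraph hr hB).trans
    (norm_discRestrict_le hrc hg (by positivity) fun w hw => norm_cpow_sub_one_mul_div_le hw h0 h1)
  have hp := polynomial_mem_discGraph X c r ((1 + Polynomial.X) ^ 3)
  have hX := polynomial_mem_discGraph X c r Polynomial.X
  have hmul := mul_mem hB hp
  have hmul' := mul_mem (sub_mem hy (one_mem (discGraph X c r))) hX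
  have e : discRestrict hrc _ hg * toContinuousMapOnAlgHom (Metric.closedBall (c : ℂ) r)
      ((1 + Polynomial.X) ^ 3) =
      (discRestrict hrc _ (differentiableOn_cpow_halfPlane (α : ℂ) le_rfl) - 1) *
        toContinuousMapOnAlgHom (Metric.closedBall (c : ℂ) r) Polynomial.X := by
    ext w
    have hw := hne w (re_pos_of_mem_ball (Metric.closedBall_subset_ball hrc w.2))
    change ((w : ℂ) ^ (α : ℂ) - 1) * w / (1 + (w : ℂ)) ^ 3 *
      ((1 + Polynomial.X : ℂ[X]) ^ 3).eval (w : ℂ) =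
      (((w : ℂ) + (0 : ℝ)) ^ (α : ℂ) - 1) * (Polynomial.X : ℂ[X]).eval (w : ℂ)
    simp only [eval_pow, eval_add, eval_one, eval_X, Complex.ofReal_zero, add_zero]
    exact div_mul_cancel₀ _ hw
  rw [Prod.mk_mul_mk, e] at hmul
  have e2 := eq_of_mem_discGraph hr hmul' hmul
  simp only [aeval_X, map_pow, map_add, map_one] at e2
  change (y - 1) * X = B * (1 + X) ^ 3 at e2
  rw [e2]
  refine (norm_mul_le _ _).trans (mul_le_mul hBn (norm_pow_le' _ (by norm_num)) (norm_nonneg _)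
    (by positivity))

theorem exists_root_of_add_smul_one {x : H →L[ℂ] H} (hx : ∀ h, 0 ≤ (inner ℂ h (x h)).re) {ε : ℝ}
    (hε : 0 < ε) {m : ℕ} (hm : 0 < m) :
    ∃ y, y ^ m = x + (ε : ℂ) • 1 ∧ IsSectorial (Real.pi / (2 * m)) y ∧
      y - ((ε ^ (m : ℝ)⁻¹ : ℝ) : ℂ) • 1 ∈ oa x ∧
      (∀ δ : ℝ, 0 < δ → ‖y‖ ≤ δ ^ (-(m : ℝ)⁻¹) * (1 + δ * ‖x + (ε : ℂ) • 1‖)) ∧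
      ‖(y - 1) * (x + (ε : ℂ) • 1)‖ ≤ 3 * (m : ℝ)⁻¹ * ‖1 + (x + (ε : ℂ) • 1)‖ ^ 3 ∧
      ∀ δ : ℝ, 0 ≤ δ → ∃ y', y' ^ m = x + ((ε + δ : ℝ) : ℂ) • 1 ∧
        IsSectorial (Real.pi / (2 * m)) y' ∧ ‖y' - y‖ ≤ δ ^ (m : ℝ)⁻¹ := by
  set X := x + (ε : ℂ) • 1 with hXdef
  have hX : ∀ h, ε * ‖h‖ ^ 2 ≤ (inner ℂ h (X h)).re := fun h => by
    have e : inner ℂ h (X h) = inner ℂ h (x h) + ((ε * ‖h‖ ^ 2 : ℝ) : ℂ) := by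
      have e' : ((ε : ℂ) • (1 : H →L[ℂ] H)) h = (ε : ℂ) • h := rfl
      rw [hXdef, add_apply, inner_add_right, e', inner_smul_right, inner_self_eq_norm_sq_to_K]
      push_cast
      rfl
    rw [e, Complex.add_re, Complex.ofReal_re]
    linarith [hx h]
  obtain ⟨c, hc⟩ : ∃ c, c = ‖X‖ ^ 2 / ε + ε := ⟨_, rfl⟩
  have hcε : ε ≤ c := by rw [hc]; linarith [show 0 ≤ ‖X‖ ^ 2 / ε by positivity]
  have hrc : c - ε / 4 < c := by linarith
  have hr : ‖X - (c : ℂ) • 1‖ < c - ε / 4 := by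
    have := norm_sub_smul_one_le hε hX
    rw [← hc] at this
    linarith
  -- The point `ε` corresponds to `x = 0`; subtracting the value there puts the root in the
  -- non-unital algebra.
  have hmem : (ε : ℂ) ∈ Metric.closedBall (c : ℂ) (c - ε / 4) := by
    rw [mem_closedBall_iff_norm, ← Complex.ofReal_sub, Complex.norm_real, Real.norm_eq_abs,
      abs_of_nonpos (by linarith)]
    linarith
  have hm0 : (0 : ℝ) < (m : ℝ)⁻¹ := by positivity
  have hm1 : (m : ℝ)⁻¹ ≤ 1 := inv_le_one_of_one_le₀ (by exact_mod_cast hm)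
  obtain ⟨y, hy, hpow, hsec⟩ := exists_root_mem_discGraph hrc hr le_rfl hm
  refine ⟨y, by simpa using hpow, hsec, ?_, fun δ hδ => norm_root_le hrc hr hm0 hm1 hδ hy,
    norm_root_sub_one_mul_le hrc hr hm0 hm1 hy, fun δ hδ => ?_⟩
  · have h1 := sub_smul_one_mem_oa hmem hy
    have h2 : discRestrict hrc _ (differentiableOn_cpow_halfPlane ((m : ℝ)⁻¹ : ℝ) le_rfl)
        ⟨(ε : ℂ), hmem⟩ = ((ε ^ (m : ℝ)⁻¹ : ℝ) : ℂ) := by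
      change ((ε : ℂ) + (0 : ℝ)) ^ (((m : ℝ)⁻¹ : ℝ) : ℂ) = _
      rw [Complex.ofReal_zero, add_zero, Complex.ofReal_cpow hε.le]
    rwa [h2] at h1
  · obtain ⟨y', hy', hpow', hsec'⟩ := exists_root_mem_discGraph hrc hr hδ hm
    refine ⟨y', ?_, hsec', ?_⟩
    · rw [hpow', hXdef, add_assoc, ← add_smul, Complex.ofReal_add]
    · have hsub : (discRestrict hrc _ (differentiableOn_cpow_halfPlane ((m : ℝ)⁻¹ : ℝ) hδ) -
          discRestrict hrc _ (differentiableOn_cpow_halfPlane ((m : ℝ)⁻¹ : ℝ) le_rfl), y' - y) ∈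
          discGraph X c (c - ε / 4) := sub_mem hy' hy
      refine (norm_le_of_mem_discGraph hr hsub).trans ?_
      refine (ContinuousMap.norm_le _ (by positivity)).2 fun w => ?_
      have hw := re_pos_of_mem_ball (Metric.closedBall_subset_ball hrc w.2)
      have := norm_add_ofReal_cpow_sub_le hw hδ hm0 hm1
      change ‖((w : ℂ) + δ) ^ (((m : ℝ)⁻¹ : ℝ) : ℂ) -
        ((w : ℂ) + (0 : ℝ)) ^ (((m : ℝ)⁻¹ : ℝ) : ℂ)‖ ≤ _
      rwa [Complex.ofReal_zero, add_zero]

/-- The sectorial root of an accretive operator, with the estimates that make the roots an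
approximate identity. -/
theorem exists_root_of_accretive {x : H →L[ℂ] H} (hx : ∀ h, 0 ≤ (inner ℂ h (x h)).re) {m : ℕ}
    (hm : 0 < m) :
    ∃ y, y ^ m = x ∧ IsSectorial (Real.pi / (2 * m)) y ∧ y ∈ oa x ∧
      (∀ δ : ℝ, 0 < δ → ‖y‖ ≤ δ ^ (-(m : ℝ)⁻¹) * (1 + δ * ‖x‖)) ∧
      ‖(y - 1) * x‖ ≤ 3 * (m : ℝ)⁻¹ * ‖1 + x‖ ^ 3 := by
  set ε : ℕ → ℝ := fun n => 1 / ((n : ℝ) + 1) with hεdef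
  have hε : ∀ n, 0 < ε n := fun n => by positivity
  have hε0 : Tendsto ε atTop (𝓝 0) := tendsto_one_div_add_atTop_nhds_zero_nat
  have hm0 : (0 : ℝ) < (m : ℝ)⁻¹ := by positivity
  have hεα : Tendsto (fun n => ε n ^ (m : ℝ)⁻¹) atTop (𝓝 0) := by
    simpa [Real.zero_rpow hm0.ne'] using hε0.rpow_const (Or.inr hm0.le)
  choose y hpow hsec hoa hnorm hone hcmp using
    fun n => exists_root_of_add_smul_one hx (hε n) hm
  -- `y n` and `y k` come from calculi on different discs. The calculus of `x + ε k` gives a root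
  -- `y'` of `x + ε n` close to `y k`, and uniqueness identifies `y'` with `y n`.
  have hdist : ∀ n k, n ≤ k → ‖y n - y k‖ ≤ ε n ^ (m : ℝ)⁻¹ := fun n k hnk => by
    have hle : ε k ≤ ε n := one_div_le_one_div_of_le (by positivity) (by gcongr)
    obtain ⟨y', hp', hs', hd'⟩ := hcmp k (ε n - ε k) (by linarith)
    rw [add_sub_cancel] at hp'
    have hcomm : Commute y' (y n) := by
      have h1 := commute_of_mem_oa (commute_of_pow_eq_add_smul_one hp') (hoa n)
      have h2 := h1.add_right ((Commute.one_right y').smul_right ((ε n ^ (m : ℝ)⁻¹ : ℝ) : ℂ))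
      rwa [sub_add_cancel] at h2
    have hsec' : IsSectorial (Real.pi / m) y' := hs'.mono (by
      have := Real.pi_pos
      have : (0 : ℝ) < m := by exact_mod_cast hm
      gcongr; linarith)
    rw [← eq_of_pow_eq_pow_of_isSectorial hm hcomm (hp'.trans (hpow n).symm) hsec' (hsec n)]
    refine hd'.trans ?_
    have := hε k
    exact Real.rpow_le_rpow (by linarith) (by linarith) hm0.le
  have hcauchy : CauchySeq y := by
    refine cauchySeq_of_le_tendsto_0 (fun n => ε n ^ (m : ℝ)⁻¹ + ε n ^ (m : ℝ)⁻¹)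
      (fun n k N hn hk => ?_) (by simpa using hεα.add hεα)
    rw [dist_eq_norm]
    calc ‖y n - y k‖ = ‖(y N - y k) - (y N - y n)‖ := by congr 1; abel
      _ ≤ ‖y N - y k‖ + ‖y N - y n‖ := norm_sub_le _ _
      _ ≤ _ := add_le_add (hdist N k hk) (hdist N n hn)
  obtain ⟨z, hz⟩ := cauchySeq_tendsto_of_complete hcauchy
  have hεC : Tendsto (fun n => (ε n : ℂ)) atTop (𝓝 0) := by
    have h := (Complex.continuous_ofReal.tendsto 0).comp hε0
    rwa [Complex.ofReal_zero] at h
  have hXt : Tendsto (fun n => x + (ε n : ℂ) • (1 : H →L[ℂ] H)) atTop (𝓝 x) := by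
    simpa using (hεC.smul_const (1 : H →L[ℂ] H)).const_add x
  refine ⟨z, ?_, ?_, ?_, fun δ hδ => ?_, ?_⟩
  · exact tendsto_nhds_unique ((hz.pow m).congr hpow) hXt
  · exact (isClosed_setOf_isSectorial _).mem_of_tendsto hz (.of_forall hsec)
  · have h1 : Tendsto (fun n => y n - ((ε n ^ (m : ℝ)⁻¹ : ℝ) : ℂ) • (1 : H →L[ℂ] H)) atTop
        (𝓝 z) := by
      have h2 : Tendsto (fun n => ((ε n ^ (m : ℝ)⁻¹ : ℝ) : ℂ)) atTop (𝓝 0) := by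
        have h := (Complex.continuous_ofReal.tendsto 0).comp hεα
        rwa [Complex.ofReal_zero] at h
      simpa using hz.sub (h2.smul_const (1 : H →L[ℂ] H))
    exact (NonUnitalSubalgebra.isClosed_topologicalClosure _).mem_of_tendsto h1 (.of_forall hoa)
  · exact le_of_tendsto_of_tendsto' hz.norm
      (((hXt.norm.const_mul δ).const_add 1).const_mul _) fun n => hnorm n δ hδ
  · exact le_of_tendsto_of_tendsto' ((hz.sub_const 1).mul hXt).norm
      (((hXt.const_add 1).norm.pow 3).const_mul _) hone

end Roots

/-! ### Limits of the roots and the approximate identity -/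

section ApproximateIdentity

variable {H : Type*} [NormedAddCommGroup H] [InnerProductSpace ℂ H]

theorem norm_normalizedOp_le_one (T : H →L[ℂ] H) : ‖normalizedOp T‖ ≤ 1 := by
  rw [normalizedOp, norm_smul, Complex.norm_real, norm_inv, norm_norm]
  exact inv_mul_le_one

theorem tendsto_mul_of_mem_oa {x : H →L[ℂ] H} {e : ℕ → H →L[ℂ] H} (he : ∀ n, ‖e n‖ ≤ 1)
    (hx : Tendsto (fun n => e n * x) atTop (𝓝 x)) {a : H →L[ℂ] H} (ha : a ∈ oa x) :
    Tendsto (fun n => e n * a) atTop (𝓝 a) := by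
  have hadj : ∀ b ∈ NonUnitalAlgebra.adjoin ℂ {x}, Tendsto (fun n => e n * b) atTop (𝓝 b) := by
    intro b hb
    induction hb using NonUnitalAlgebra.adjoin_induction with
    | mem b hb => rwa [Set.mem_singleton_iff.1 hb]
    | add a b _ _ ha hb => simpa only [mul_add] using ha.add hb
    | zero => simp
    | mul a b _ _ ha hb => simpa only [mul_assoc] using ha.mul_const b
    | smul r a _ ha => simpa only [mul_smul_comm] using ha.const_smul r
  rw [Metric.tendsto_atTop]
  intro ε hε
  obtain ⟨b, hb, hab⟩ := Metric.mem_closure_iff.1 (show a ∈ closure _ from ha) (ε / 3) (by positivity)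
  obtain ⟨N, hN⟩ := Metric.tendsto_atTop.1 (hadj b hb) (ε / 3) (by positivity)
  refine ⟨N, fun n hn => ?_⟩
  have h1 := hN n hn
  rw [dist_eq_norm] at hab h1 ⊢
  have h2 : ‖e n * (a - b)‖ ≤ ‖a - b‖ :=
    (norm_mul_le _ _).trans (mul_le_of_le_one_left (norm_nonneg _) (he n))
  calc ‖e n * a - a‖ = ‖e n * (a - b) + (e n * b - b) - (a - b)‖ := by
        congr 1; rw [mul_sub]; abel
    _ ≤ ‖e n * (a - b)‖ + ‖e n * b - b‖ + ‖a - b‖ :=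
        (norm_sub_le _ _).trans (add_le_add_left (norm_add_le _ _) _)
    _ < ε := by linarith

theorem tendsto_mul_of_norm_sub_one_mul_le {x : H →L[ℂ] H} {y : ℕ → H →L[ℂ] H} {C : ℝ}
    (h : ∀ m : ℕ, 0 < m → ‖(y m - 1) * x‖ ≤ 3 * (m : ℝ)⁻¹ * C) :
    Tendsto (fun m => y m * x) atTop (𝓝 x) := by
  rw [tendsto_iff_norm_sub_tendsto_zero]
  have h1 : Tendsto (fun m : ℕ => 3 * (m : ℝ)⁻¹ * C) atTop (𝓝 0) := by
    simpa using (tendsto_inv_atTop_nhds_zero_nat (𝕜 := ℝ)).const_mul 3 |>.mul_const C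
  refine squeeze_zero' (.of_forall fun _ => norm_nonneg _) ?_ h1
  filter_upwards [eventually_gt_atTop 0] with m hm
  simpa [sub_mul] using h m hm

/-- Below, `‖y m‖ ≥ ‖y m * x‖ / ‖x‖`. Above, `δ = 1/m` gives `m^(1/m) (1 + ‖x‖/m)`. -/
theorem tendsto_norm_of_norm_le {x : H →L[ℂ] H} (hx : x ≠ 0) {y : ℕ → H →L[ℂ] H}
    (h : ∀ m : ℕ, 0 < m → ∀ δ : ℝ, 0 < δ → ‖y m‖ ≤ δ ^ (-(m : ℝ)⁻¹) * (1 + δ * ‖x‖))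
    (hy : Tendsto (fun m => y m * x) atTop (𝓝 x)) : Tendsto (fun m => ‖y m‖) atTop (𝓝 1) := by
  have hx' : ‖x‖ ≠ 0 := norm_ne_zero_iff.2 hx
  have hlow : Tendsto (fun m => ‖y m * x‖ / ‖x‖) atTop (𝓝 1) := by
    simpa [hx'] using hy.norm.div_const ‖x‖
  have hup : Tendsto (fun m : ℕ => (m : ℝ) ^ (1 / (m : ℝ)) * (1 + (m : ℝ)⁻¹ * ‖x‖)) atTop
      (𝓝 1) := by
    have h1 : Tendsto (fun m : ℕ => (m : ℝ) ^ (1 / (m : ℝ))) atTop (𝓝 1) :=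
      tendsto_rpow_div.comp tendsto_natCast_atTop_atTop
    have h2 := ((tendsto_inv_atTop_nhds_zero_nat (𝕜 := ℝ)).mul_const ‖x‖).const_add 1
    simpa using h1.mul h2
  refine tendsto_of_tendsto_of_tendsto_of_le_of_le' hlow hup (.of_forall fun m => ?_) ?_
  · exact (div_le_iff₀ (norm_pos_iff.2 hx)).2 (norm_mul_le _ _)
  · filter_upwards [eventually_gt_atTop 0] with m hm
    have hm' : (0 : ℝ) < m := by exact_mod_cast hm
    have h1 := h m hm (m : ℝ)⁻¹ (by positivity)
    rw [Real.inv_rpow hm'.le, Real.rpow_neg hm'.le, inv_inv] at h1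
    rwa [one_div]

theorem tendsto_normalizedOp_mul {x : H →L[ℂ] H} {y : ℕ → H →L[ℂ] H}
    (hy : Tendsto (fun m => y m * x) atTop (𝓝 x))
    (hn : x ≠ 0 → Tendsto (fun m => ‖y m‖) atTop (𝓝 1)) :
    Tendsto (fun m => normalizedOp (y m) * x) atTop (𝓝 x) := by
  rcases eq_or_ne x 0 with rfl | hx
  · simp
  have h1 : Tendsto (fun m => ((‖y m‖⁻¹ : ℝ) : ℂ)) atTop (𝓝 1) := by
    have h := (Complex.continuous_ofReal.tendsto _).comp ((hn hx).inv₀ one_ne_zero)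
    rwa [inv_one, Complex.ofReal_one] at h
  simpa [normalizedOp, smul_mul_assoc] using h1.smul hy

variable [CompleteSpace H]

theorem re_inner_nonneg_of_add_star_nonneg {x : H →L[ℂ] H} (hx : 0 ≤ x + star x) (h : H) :
    0 ≤ (inner ℂ h (x h)).re := by
  have h1 := ((ContinuousLinearMap.nonneg_iff_isPositive _).1 hx).inner_nonneg_right h
  rw [add_apply, inner_add_right, ContinuousLinearMap.star_eq_adjoint,
    ContinuousLinearMap.adjoint_inner_right, ← inner_conj_symm (x h) h, Complex.le_def] at h1
  have h2 := h1.1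
  simp only [Complex.zero_re, Complex.add_re, Complex.conj_re] at h2
  linarith

theorem isSectorialRoot_iff {x z : H →L[ℂ] H} {m : ℕ} (hm : 0 < m) (hz : z ^ m = x)
    (hsec : IsSectorial (Real.pi / (2 * m)) z) (hoa : z ∈ oa x) (y : H →L[ℂ] H) :
    IsSectorialRoot x m y ↔ y = z := by
  have hpi := Real.pi_pos
  have hm1 : (1 : ℝ) ≤ m := by exact_mod_cast hm
  constructor
  · rintro ⟨hy, hW⟩
    -- `y` commutes with its power `x`, hence with `z ∈ oa x`, as the uniqueness theorem requires.
    have hcomm : Commute y x := hy ▸ (Commute.refl y).pow_right m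
    exact eq_of_pow_eq_pow_of_isSectorial hm (commute_of_mem_oa hcomm hoa) (hy.trans hz.symm)
      (.of_numericalRange fun w hw => abs_le.2 ⟨(hW w hw).1.le, (hW w hw).2.le⟩) hsec
  · rintro rfl
    refine ⟨hz, fun w hw => ?_⟩
    have h1 := hsec.abs_arg_le (by positivity) (by gcongr; linarith) hw
    have h2 : Real.pi / (2 * m) < Real.pi / m := by gcongr; linarith
    exact abs_lt.1 (h1.trans_lt h2)

theorem sectorialRoot_eq {x z : H →L[ℂ] H} {m : ℕ} (hm : 0 < m) (hz : z ^ m = x)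
    (hsec : IsSectorial (Real.pi / (2 * m)) z) (hoa : z ∈ oa x) : sectorialRoot x m = z := by
  have h := isSectorialRoot_iff hm hz hsec hoa
  exact (h _).1 (Classical.epsilon_spec ⟨z, (h z).2 rfl⟩)

end ApproximateIdentity

/-- The approximate identity is indexed from `n + 1` because the root of order `0` is arbitrary. The
normalization of `0` is `0`, as `0⁻¹ = 0`. -/
theorem theorem3p1 {H : Type*} [NormedAddCommGroup H] [InnerProductSpace ℂ H] [CompleteSpace H]
    (x : H →L[ℂ] H) (hx : 0 ≤ x + star x) :
    (∀ m : ℕ, 1 ≤ m →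
      IsSectorialRoot x m (sectorialRoot x m) ∧
        ∀ y : H →L[ℂ] H, IsSectorialRoot x m y → y = sectorialRoot x m) ∧
    Tendsto (fun m : ℕ => sectorialRoot x m * x) atTop (𝓝 x) ∧
    (x ≠ 0 → Tendsto (fun m : ℕ => ‖sectorialRoot x m‖) atTop (𝓝 1)) ∧
    IsContractiveApproxIdentity (oa x)
      (fun n : ℕ => normalizedOp (sectorialRoot x (n + 1))) := by
  have hroot : ∀ m : ℕ, 0 < m → (sectorialRoot x m) ^ m = x ∧
      IsSectorial (Real.pi / (2 * m)) (sectorialRoot x m) ∧ sectorialRoot x m ∈ oa x ∧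
      (∀ δ : ℝ, 0 < δ → ‖sectorialRoot x m‖ ≤ δ ^ (-(m : ℝ)⁻¹) * (1 + δ * ‖x‖)) ∧
      ‖(sectorialRoot x m - 1) * x‖ ≤ 3 * (m : ℝ)⁻¹ * ‖1 + x‖ ^ 3 := fun m hm => by
    obtain ⟨z, hz⟩ := exists_root_of_accretive (re_inner_nonneg_of_add_star_nonneg hx) hm
    rwa [sectorialRoot_eq hm hz.1 hz.2.1 hz.2.2.1]
  have hmul : Tendsto (fun m : ℕ => sectorialRoot x m * x) atTop (𝓝 x) :=
    tendsto_mul_of_norm_sub_one_mul_le fun m hm => (hroot m hm).2.2.2.2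
  have hnorm : x ≠ 0 → Tendsto (fun m : ℕ => ‖sectorialRoot x m‖) atTop (𝓝 1) := fun h0 =>
    tendsto_norm_of_norm_le h0 (fun m hm => (hroot m hm).2.2.2.1) hmul
  have hmem : ∀ n : ℕ, normalizedOp (sectorialRoot x (n + 1)) ∈ oa x := fun n =>
    SMulMemClass.smul_mem _ (hroot (n + 1) n.succ_pos).2.2.1
  have hleft : ∀ a ∈ oa x,
      Tendsto (fun n : ℕ => normalizedOp (sectorialRoot x (n + 1)) * a) atTop (𝓝 a) := fun a ha =>
    tendsto_mul_of_mem_oa (fun n => norm_normalizedOp_le_one _)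
      ((tendsto_normalizedOp_mul hmul hnorm).comp (tendsto_add_atTop_nat 1)) ha
  refine ⟨fun m hm => ?_, hmul, hnorm, hmem, fun n => norm_normalizedOp_le_one _, hleft,
    fun a ha => ?_⟩
  · have h := isSectorialRoot_iff hm (hroot m hm).1 (hroot m hm).2.1 (hroot m hm).2.2.1
    exact ⟨(h _).2 rfl, fun y hy => (h y).1 hy⟩
  -- `oa x` is commutative, so the right-hand limit is the left-hand one.
  · refine (hleft a ha).congr fun n => ?_
    have hax : Commute a x := (commute_of_mem_oa (Commute.refl x) ha).symm
    exact (commute_of_mem_oa hax (hmem n)).eq.symm
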